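/- Let $T$ be a complete first order theory in a vocabulary $\tau$ which has the independence property, i.e. some formula $\varphi(\bar x,\bar y)$ has the independence property for $T$: in models of $T$ there are, for every $n<\omega$, tuples $\bar b_0,\dots,\bar b_{n-1}$ such that for every $s\subseteq\{0,\dots,n-1\}$ some $\bar a$ satisfies $\varphi(\bar a,\bar b_i)$ exactly for $i\in s$. Let $\lambda=\lambda^{<\lambda}$ be a regular uncountable cardinal with $\lambda>|\tau|+\aleph_0$ and $2^\lambda=\lambda^+$, and let $\kappa<\lambda$ be an infinite regular cardinal. (1) Let $M$ be a saturated model of $T$ of cardinality $\lambda^+$ and let $\langle M_\alpha:\alpha<\lambda^+\rangle$ be a $\prec$-increasing continuous sequence of models of cardinality $\lambda$ with union $M$. Then there is a club $E$ of $\lambda^+$ such that for any two distinct $\delta_1,\delta_2\in E$ of cofinality $\kappa$, the models $M_{\delta_1}$ and $M_{\delta_2}$ are not isomorphic; moreover, for every formula $\varphi(\bar x,\bar y)$ which has the independence property for $T$, $$\mathrm{inv}^{\varphi}_{8,\kappa}(M_{\delta_1})\neq \mathrm{inv}^{\varphi}_{8,\kappa}(M_{\delta_2}).$$ Here, for a model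 $N$ of cardinality $\lambda$, $\mathrm{inv}^{\varphi}_{8,\kappa}(N)$ is the class of the sequence $\langle \mathrm{inv}^\varphi_{7,\kappa}(\delta,N'):\delta<\lambda\rangle$ modulo the club filter on $\lambda$, for any $N'\cong N$ with universe $\lambda$ (the inequality holds for every choice of such models for $N=M_{\delta_1}$ and $N=M_{\delta_2}$), and $\mathrm{inv}^\varphi_{7,\kappa}(\delta,N')$ is the set of all families $\mathcal P\subseteq\mathcal P(\delta)$ for which there are tuples $\bar a^i_\gamma$ ($i<\kappa$, $\gamma<\delta$) of elements of $\delta$ such that for every $U\subseteq\delta$: $U\in\mathcal P$ iff there is a tuple $\bar b$ in $N'$ such that for all large enough $i<\kappa$ and all $\gamma<\delta$, $N'\models\varphi[\bar a^i_\gamma,\bar b]$ iff $\gamma\in U$. (2) Consequently $T$ has no $(\lambda,\kappa)$-limit model, i.e. there is no model $M_*$ such that for some sequence $\langle M_\alpha:\alpha<\lambda^+\rangle$ as in (1) and some club $E$ of $\lambda^+$, $M_\delta\cong M_*$ for all $\delta\in E$ of cofinality $\kappa$. -/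

import Mathlib

open Cardinal Set FirstOrder

universe u

namespace LimitModel

/-- The club filter on the ordinal `o` (used for `o` an uncountable regular cardinal), as a filter
on the set of ordinals below `o`: the filter generated by the closed unbounded subsets of `o`. -/
def clubFilter (o : Ordinal.{u}) : Filter (Iio o) :=
  Filter.generate {C | IsClub C}

/-- For an uncountable regular cardinal, a set is in the club filter iff it contains a club. -/
theorem mem_clubFilter_iff {lam : Cardinal.{u}} (hreg : lam.IsRegular) (hunc : ℵ₀ < lam)
    {s : Set (Iio lam.ord)} :
    s ∈ clubFilter lam.ord ↔ ∃ C : Set (Iio lam.ord), IsClub C ∧ C ⊆ s := by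
  have hcof : Order.cof (Iio lam.ord) ≠ ℵ₀ := by
    rw [Ordinal.cof_Iio, ← Ordinal.lift_cof, hreg.cof_ord, ← Cardinal.lift_aleph0.{u + 1, u}]
    exact fun h => hunc.ne' (Cardinal.lift_injective h)
  constructor
  · intro h
    induction h with
    | basic h => exact ⟨_, h, subset_rfl⟩
    | univ => exact ⟨univ, IsClub.univ, subset_rfl⟩
    | superset _ hst ih =>
      obtain ⟨C, hC, hCs⟩ := ih
      exact ⟨C, hC, hCs.trans hst⟩
    | inter _ _ ih₁ ih₂ =>
      obtain ⟨C, hC, hCs⟩ := ih₁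
      obtain ⟨D, hD, hDs⟩ := ih₂
      exact ⟨C ∩ D, hC.inter hcof hD, inter_subset_inter hCs hDs⟩
  · rintro ⟨C, hC, hCs⟩
    exact Filter.mem_of_superset (Filter.mem_generate_of_mem hC) hCs

variable {L : FirstOrder.Language.{u, u}}

/-- The formula `φ(x̄, ȳ)` has the independence property for `T`: in every model of `T` there are,
for every `n`, tuples `b̄ 0, …, b̄ (n - 1)` such that every `s ⊆ {0, …, n - 1}` is of the form
`{i | φ(ā, b̄ i)}` for some tuple `ā`. -/
def FormulaHasIP (T : L.Theory) {m k : ℕ} (φ : L.Formula (Fin m ⊕ Fin k)) : Prop :=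
  ∀ (M : FirstOrder.Language.Theory.ModelType.{u, u, u} T) (n : ℕ), ∃ b : Fin n → Fin k → M,
    ∀ s : Set (Fin n), ∃ a : Fin m → M, ∀ i, φ.Realize (Sum.elim a (b i)) ↔ i ∈ s

/-- The theory `T` has the independence property (is independent): some formula has it. -/
def HasIP (T : L.Theory) : Prop :=
  ∃ (m k : ℕ) (φ : L.Formula (Fin m ⊕ Fin k)), FormulaHasIP T φ

/-- `M` is saturated: every complete 1-type over a set of fewer than `|M|` parameters from `M`
(that is, a complete type of the theory of `M` with these parameters named) is realized in `M`. -/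
def IsSaturated (L : FirstOrder.Language.{u, u}) (M : Type u) [L.Structure M] [Nonempty M] : Prop :=
  ∀ A : Set M, #A < #M → ∀ p : (L[[A]].completeTheory M).CompleteType (Fin 1),
    p ∈ (L[[A]].completeTheory M).realizedTypes M (Fin 1)

/-- `M` is a saturated model of `T` of cardinality `λ⁺`, and `⟨Ms α : α < λ⁺⟩` is an
elementarily increasing continuous sequence of models of cardinality `λ` with union `M`. (The
members of such a sequence are elementary submodels of its union `M`; and of two elementary
submodels of `M`, one included in the other, the smaller is an elementary submodel of the
larger.) -/
structure IsSaturatedChain (T : L.Theory) (lam : Cardinal.{u}) (M : Type u) [L.Structure M]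
    [Nonempty M] (Ms : Iio (Order.succ lam).ord → L.ElementarySubstructure M) : Prop where
  model : M ⊨ T
  saturated : IsSaturated L M
  card_eq : #M = Order.succ lam
  mono : Monotone Ms
  continuous : ∀ δ : Iio (Order.succ lam).ord, Order.IsSuccLimit (δ : Ordinal) →
    (Ms δ : Set M) = ⋃ α, ⋃ (_ : α < δ), (Ms α : Set M)
  iUnion_eq : (⋃ α, (Ms α : Set M)) = Set.univ
  card_stage : ∀ α, #(Ms α) = lam

/-- `Mstar` is a `(λ, κ)`-limit model of `T` (in the case `2 ^ λ = λ⁺`): for a sequence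
`⟨Ms α : α < λ⁺⟩` as above there is a club `E` of `λ⁺` such that `Ms δ ≅ Mstar` for all `δ ∈ E` of
cofinality `κ`. That is, the least number of isomorphism types of the `Ms δ` with `δ ∈ E` of
cofinality `κ`, over all clubs `E` of `λ⁺`, is one, and `Mstar` represents that type. -/
def IsLimitModel (T : L.Theory) (lam kappa : Cardinal.{u}) (Mstar : Type u)
    [L.Structure Mstar] : Prop :=
  ∃ (M : Type u) (_ : L.Structure M) (_ : Nonempty M)
    (Ms : Iio (Order.succ lam).ord → L.ElementarySubstructure M),
    IsSaturatedChain T lam M Ms ∧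
    ∃ E : Set (Iio (Order.succ lam).ord), IsClub E ∧
      ∀ δ ∈ E, (δ : Ordinal).cof = kappa → Nonempty (Ms δ ≃[L] Mstar)

section Invariant

variable {N : Type u} [L.Structure N] {lam : Cardinal.{u}} {m k : ℕ}

/-- The local invariant at `δ < λ` of the model with universe `λ` obtained from `N` by
transporting its structure along the bijection `e : N ≃ λ`. It is the set of those families `P` of
subsets of `δ` for which there are tuples `a i γ` (`i < κ`, `γ < δ`) of elements of `δ` such that
`U ∈ P` iff for some tuple `b` of the model, for all large enough `i < κ` and all `γ < δ`,
`φ(a i γ, b)` holds exactly when `γ ∈ U`. -/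
def localInv (φ : L.Formula (Fin m ⊕ Fin k)) (kappa : Cardinal.{u}) (e : N ≃ Iio lam.ord)
    (δ : Iio lam.ord) : Set (Set (Set (Iio (δ : Ordinal)))) :=
  {P | ∃ a : Iio kappa.ord → Iio (δ : Ordinal) → Fin m → N,
    (∀ i γ j, e (a i γ j) < δ) ∧
    ∀ U : Set (Iio (δ : Ordinal)), U ∈ P ↔
      ∃ b : Fin k → N, ∃ i₀ : Iio kappa.ord, ∀ i, i₀ ≤ i →
        ∀ γ, φ.Realize (Sum.elim (a i γ) b) ↔ γ ∈ U}

/-- The invariant of a model `N` of cardinality `λ`: the sequence of the local invariants at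
`δ < λ`, modulo the club filter on `λ`, computed through the bijection `e : N ≃ λ`. -/
noncomputable def clubInv (φ : L.Formula (Fin m ⊕ Fin k)) (kappa : Cardinal.{u}) (e : N ≃ Iio lam.ord) :
    (clubFilter lam.ord).Product fun δ => Set (Set (Set (Iio (δ : Ordinal)))) :=
  Quotient.mk _ (localInv φ kappa e)

end Invariant

end LimitModel

/-!
Let `φ` have the independence property and let `N` be one of the models of the chain, of
cardinality `lam` and enumerated by `lam`. For a sequence `D γ` (`γ < lam`) of ultrafilters on the
tuples of the big model `M`, the pattern of a tuple `b` is the set of those `γ` for which `φ(x, b)`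
holds for `D γ`-almost all `x`. The local invariant of a later model `N'` of cofinality `kappa` at
`δ` contains the family of all patterns of `D` cut down to `δ`, for a club of `δ`, as soon as there
are at most `lam` patterns: by saturation every `D γ` has an average over each model of the chain
(`IsSaturated.exists_average`), and if `N'` is closed under the choice of these averages and of
witnesses for the patterns, then the averages over a cofinal sequence of `kappa` models below `N'`
are the tuples required (`exists_club_range_mem_localInv`).

On the other hand, the local invariant of `N` at `δ` has at most `2 ^ |δ|` members
(`mk_localInv_le`), and `D` can be chosen, with at most `lam` patterns, such that for stationarily
many `δ` the family of patterns below `δ` is none of them (`exists_ultrafilters`). Hence the local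
invariants of `N` and `N'` differ at stationarily many `δ`; as the local invariants do not depend on
the enumeration up to a club, the invariants modulo the club filter differ. The choice of `D` is a
matter of set theory, since by saturation `φ` represents every relation between sets of size
at most `lam` (`IsSaturated.exists_represents`). There are two cases.

* If `lam = 2 ^ μ` for some `μ < lam`, take `μ` many tuples of which the formulas `φ(x, b)` cut out
  every subset; every `D γ` is either principal at one of these tuples or the image of a single
  ultrafilter `d` on their index set. The family of patterns determines `d`, and as there is an
  independent family of `2 ^ μ` sets, `d` can be made to differ from what each of the `2 ^ μ`
  families to be avoided would require.
* If `lam` is a strong limit, take independent sets `N j` defined by `φ`, where `j` ranges over the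
  pairs of an ordinal `δ < lam` and a subset of `δ`. For every point `x` of the Cantor cube `2 ^ J`
  there is an ultrafilter `D x` which contains the sets `N j` with `x j = 1` and no others, such that
  the membership of any fixed set in `D x` depends on countably many coordinates of `x`
  (`exists_ultrafilter_countable_support`). This uses a section of the projection of the
  ultrafilters to the cube whose image is in a minimal closed set mapping onto the cube, and the
  countable chain condition of the cube. It leaves only `lam` patterns, and for sets coded at
  ordinals `δ` of cofinality `ω₁` that are almost disjoint below `δ`, such a set is a pattern below
  `δ` only if it was made one (`exists_separated_family`). So the family of patterns below `δ` can
  be diagonalized against `2 ^ |δ|` families.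

For the second part, a limit model would be isomorphic to all members of cofinality `kappa` of a
club of models of the chain, while by the first part two of them are not isomorphic.
-/

universe v

namespace LimitModel

/-! ### Ultrafilters indexed by the points of a Cantor cube -/

section CantorCube

open Topology Filter MeasureTheory

/-- The basic clopen subset of `J → Bool` of the points that agree with `x` on `W`. -/
def cylinderAt {J : Type*} (x : J → Bool) (W : Finset J) : Set (J → Bool) :=
  {y | ∀ j ∈ W, y j = x j}

theorem cylinderAt_eq_pi {J : Type*} (x : J → Bool) (W : Finset J) :
    cylinderAt x W = (W : Set J).pi fun j => {x j} := by
  ext y; simp [cylinderAt, Set.mem_pi]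

theorem isOpen_cylinderAt {J : Type*} (x : J → Bool) (W : Finset J) :
    IsOpen (cylinderAt x W) := by
  rw [cylinderAt_eq_pi]
  exact isOpen_set_pi W.finite_toSet fun _ _ => isOpen_discrete _

theorem mem_cylinderAt_self {J : Type*} (x : J → Bool) (W : Finset J) : x ∈ cylinderAt x W :=
  fun _ _ => rfl

theorem exists_cylinderAt_subset {J : Type*} {O : Set (J → Bool)} (hO : IsOpen O) {x : J → Bool}
    (hx : x ∈ O) : ∃ W, cylinderAt x W ⊆ O := by
  obtain ⟨W, v, hv, hsub⟩ := isOpen_pi_iff.1 hO x hx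
  refine ⟨W, fun y hy => hsub fun j hj => ?_⟩
  rw [hy j hj]
  exact (hv j hj).2

/-- The space `J → Bool` satisfies the countable chain condition, here for cylinders: a cylinder
has positive measure for the product of fair coin tosses. -/
theorem countable_of_pairwiseDisjoint_cylinderAt {J : Type*} {A : Set (Set (J → Bool))}
    (hA : ∀ c ∈ A, ∃ x W, c = cylinderAt x W) (hdisj : A.PairwiseDisjoint id) : A.Countable := by
  let μ : J → Measure Bool := fun _ => ProbabilityTheory.uniformOn Set.univ
  have hμ : ∀ j, IsProbabilityMeasure (μ j) := fun j =>
    ProbabilityTheory.isProbabilityMeasure_uniformOn Set.finite_univ Set.univ_nonempty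
  have hpos : ∀ c : A, 0 < Measure.infinitePi μ c.1 := by
    rintro ⟨c, hc⟩
    obtain ⟨x, W, rfl⟩ := hA c hc
    change 0 < Measure.infinitePi μ (cylinderAt x W)
    rw [cylinderAt_eq_pi, Measure.infinitePi_pi μ (fun _ _ => measurableSet_singleton _),
      pos_iff_ne_zero, Finset.prod_ne_zero_iff]
    intro j _ h0
    have := (ProbabilityTheory.uniformOn_eq_zero_iff (s := (Set.univ : Set Bool)) (t := {x j})
      Set.finite_univ).1 h0
    simp at this
  have hmeas : ∀ c : A, MeasurableSet c.1 := by
    rintro ⟨c, hc⟩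
    obtain ⟨x, W, rfl⟩ := hA c hc
    change MeasurableSet (cylinderAt x W)
    rw [cylinderAt_eq_pi]
    exact MeasurableSet.pi W.countable_toSet fun _ _ => measurableSet_singleton _
  have := Measure.countable_meas_pos_of_disjoint_iUnion (μ := Measure.infinitePi μ) hmeas
    (fun c d hcd => hdisj c.2 d.2 fun h => hcd (Subtype.ext h))
  have huniv : {i : A | 0 < Measure.infinitePi μ i.1} = Set.univ := by
    ext i; simp [hpos i]
  rw [huniv] at this
  exact Set.countable_coe_iff.1 (Set.countable_univ_iff.1 this)

/-- A set with nowhere dense frontier in `J → Bool` agrees, on a dense open set, with a set that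
depends on countably many coordinates only. -/
theorem exists_countable_support {J : Type*} {S : Set (J → Bool)}
    (hS : Dense (interior S ∪ interior Sᶜ)) :
    ∃ w : Set J, w.Countable ∧ ∃ A B : Set (J → Bool), IsOpen A ∧ IsOpen B ∧ A ⊆ S ∧ B ⊆ Sᶜ ∧
      Dense (A ∪ B) ∧ (∀ x y, (∀ j ∈ w, x j = y j) → x ∈ A → y ∈ A) ∧
      (∀ x y, (∀ j ∈ w, x j = y j) → x ∈ B → y ∈ B) := by
  let P : Set (Set (J → Bool)) := {c | (∃ x W, c = cylinderAt x W) ∧ (c ⊆ S ∨ c ⊆ Sᶜ)}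
  obtain ⟨F, hF⟩ := zorn_subset {F : Set (Set (J → Bool)) | F ⊆ P ∧ F.PairwiseDisjoint id} (by
    intro ch hch hchain
    refine ⟨⋃₀ ch, ⟨Set.sUnion_subset fun F hF => (hch hF).1, ?_⟩,
      fun F hF => Set.subset_sUnion_of_mem hF⟩
    exact (Set.pairwiseDisjoint_sUnion hchain.directedOn).2 fun F hF => (hch hF).2)
  have hFP := hF.prop.1
  have hcount : F.Countable :=
    countable_of_pairwiseDisjoint_cylinderAt (fun c hc => (hFP hc).1) hF.prop.2
  have hch : ∀ c : F, ∃ W : Finset J, ∃ x, c.1 = cylinderAt x W := fun c => by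
    obtain ⟨x, W, h⟩ := (hFP c.2).1
    exact ⟨W, x, h⟩
  choose W x hW using hch
  have hopen : ∀ c ∈ F, IsOpen c := by
    intro c hc
    rw [show c = _ from hW ⟨c, hc⟩]
    exact isOpen_cylinderAt _ _
  have hsupp : ∀ c ∈ F, ∀ y z : J → Bool, (∀ j ∈ ⋃ c : F, (W c : Set J), y j = z j) →
      y ∈ c → z ∈ c := by
    intro c hc y z hyz hy
    rw [show c = _ from hW ⟨c, hc⟩] at hy ⊢
    intro j hj
    rw [← hyz j (Set.mem_iUnion.2 ⟨⟨c, hc⟩, hj⟩)]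
    exact hy j hj
  refine ⟨⋃ c : F, (W c : Set J), ?_, ⋃₀ {c ∈ F | c ⊆ S}, ⋃₀ {c ∈ F | c ⊆ Sᶜ},
    isOpen_sUnion fun c hc => hopen c hc.1, isOpen_sUnion fun c hc => hopen c hc.1,
    Set.sUnion_subset fun c hc => hc.2, Set.sUnion_subset fun c hc => hc.2, ?_, ?_, ?_⟩
  · have := hcount.to_subtype
    exact Set.countable_iUnion fun c => (W c).countable_toSet
  · rw [dense_iff_inter_open]
    intro O hO hne
    have hO' : IsOpen (interior S ∪ interior Sᶜ) := isOpen_interior.union isOpen_interior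
    obtain ⟨y, hyO, hy⟩ := hS.inter_open_nonempty O hO hne
    obtain ⟨V, hVO, hV⟩ : ∃ V, cylinderAt y V ⊆ O ∧ (cylinderAt y V ⊆ S ∨ cylinderAt y V ⊆ Sᶜ) := by
      rcases hy with hy | hy
      · obtain ⟨V, hV⟩ := exists_cylinderAt_subset (hO.inter isOpen_interior) ⟨hyO, hy⟩
        exact ⟨V, hV.trans Set.inter_subset_left,
          Or.inl (hV.trans (Set.inter_subset_right.trans interior_subset))⟩
      · obtain ⟨V, hV⟩ := exists_cylinderAt_subset (hO.inter isOpen_interior) ⟨hyO, hy⟩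
        exact ⟨V, hV.trans Set.inter_subset_left,
          Or.inr (hV.trans (Set.inter_subset_right.trans interior_subset))⟩
    by_cases hd : ∃ c ∈ F, (cylinderAt y V ∩ c).Nonempty
    · obtain ⟨c, hc, z, hz, hzc⟩ := hd
      refine ⟨z, hVO hz, ?_⟩
      rcases (hFP hc).2 with h | h
      · exact Or.inl ⟨c, ⟨hc, h⟩, hzc⟩
      · exact Or.inr ⟨c, ⟨hc, h⟩, hzc⟩
    · push Not at hd
      -- otherwise the cylinder could be added to the maximal disjoint family
      have hins : insert (cylinderAt y V) F ∈
          {F : Set (Set (J → Bool)) | F ⊆ P ∧ F.PairwiseDisjoint id} := by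
        refine ⟨Set.insert_subset ⟨⟨y, V, rfl⟩, hV⟩ hFP, ?_⟩
        refine (Set.pairwiseDisjoint_insert).2 ⟨hF.prop.2, fun c hc _ => ?_⟩
        exact Set.disjoint_iff_inter_eq_empty.2 (hd c hc)
      have hmem : cylinderAt y V ∈ F :=
        hF.le_of_ge hins (Set.subset_insert _ _) (Set.mem_insert _ _)
      have := hd _ hmem
      rw [Set.inter_self] at this
      exact absurd (mem_cylinderAt_self y V) (by rw [this]; exact Set.notMem_empty _)
  · rintro y z hyz ⟨c, hc, hy⟩
    exact ⟨c, hc, hsupp c hc.1 y z hyz hy⟩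
  · rintro y z hyz ⟨c, hc, hy⟩
    exact ⟨c, hc, hsupp c hc.1 y z hyz hy⟩

/-- The sets `N j` are independent: finitely many conditions `c ∈ N j` or `c ∉ N j` can be met
together. Then an ultrafilter can contain any prescribed ones among them and no others. -/
theorem exists_ultrafilter_mem_iff {Ω ι : Type*} (N : ι → Set Ω)
    (hN : ∀ (x : ι → Prop) (W : Finset ι), ∃ c, ∀ j ∈ W, c ∈ N j ↔ x j) (x : ι → Prop) :
    ∃ v : Ultrafilter Ω, ∀ j, N j ∈ v ↔ x j := by
  classical
  obtain ⟨v, hv⟩ := Ultrafilter.exists_ultrafilter_of_finite_inter_nonempty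
    (Set.range fun j => {c | c ∈ N j ↔ x j}) (by
      intro T hT
      have : ∀ t : T, ∃ j, {c | c ∈ N j ↔ x j} = t.1 := fun t => hT t.2
      choose f hf using this
      obtain ⟨c, hc⟩ := hN x (Finset.univ.image f)
      refine ⟨c, fun t ht => ?_⟩
      rw [show t = _ from (hf ⟨t, ht⟩).symm]
      exact hc _ (Finset.mem_image_of_mem _ (Finset.mem_univ _)))
  refine ⟨v, fun j => ?_⟩
  have hj : {c | c ∈ N j ↔ x j} ∈ v := hv ⟨j, rfl⟩
  by_cases hx : x j
  · simp only [hx, iff_true] at hj ⊢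
    exact hj
  · simp only [hx, iff_false] at hj ⊢
    exact Ultrafilter.compl_mem_iff_notMem.1 hj

/-- Independent sets `N j` have an ultrafilter-valued section over `J → Bool`, along which the
membership of each fixed set is a set with nowhere dense frontier. The section takes its values in
a minimal closed set of ultrafilters that maps onto `J → Bool`. -/
theorem exists_section {Ω J : Type u} (N : J → Set Ω)
    (hN : ∀ (x : J → Prop) (W : Finset J), ∃ c, ∀ j ∈ W, c ∈ N j ↔ x j) :
    ∃ σ : (J → Bool) → Ultrafilter Ω, (∀ x j, N j ∈ σ x ↔ x j = true) ∧
      ∀ Y : Set Ω, Dense (interior {x | Y ∈ σ x} ∪ interior {x | Y ∈ σ x}ᶜ) := by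
  classical
  let p : Ultrafilter Ω → J → Bool := fun v j => decide (N j ∈ v)
  have hpc : Continuous p := by
    refine continuous_pi fun j => ?_
    rw [continuous_discrete_rng]
    intro b
    cases b
    · have : (fun v : Ultrafilter Ω => p v j) ⁻¹' {false} = {v | (N j)ᶜ ∈ v} := by
        ext v; simp [p, Ultrafilter.compl_mem_iff_notMem]
      rw [this]
      exact ultrafilter_isOpen_basic _
    · have : (fun v : Ultrafilter Ω => p v j) ⁻¹' {true} = {v | N j ∈ v} := by
        ext v; simp [p]
      rw [this]
      exact ultrafilter_isOpen_basic _
  have hps : Function.Surjective p := by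
    intro x
    obtain ⟨v, hv⟩ := exists_ultrafilter_mem_iff N hN fun j => x j = true
    exact ⟨v, funext fun j => by simp [p, hv]⟩
  obtain ⟨E, hEc, hEon, hEmin⟩ := exists_compact_surjective_zorn_subset hpc hps
  have hsec : ∀ x, ∃ v ∈ E, p v = x := fun x => by
    have : x ∈ p '' E := hEon ▸ Set.mem_univ x
    exact this
  choose σ hσE hσ using hsec
  have hEcl : IsClosed E := (isCompact_iff_compactSpace.2 hEc).isClosed
  refine ⟨σ, fun x j => ?_, fun Y => ?_⟩
  · have := congrFun (hσ x) j
    rw [← this]; simp [p]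
  · rw [dense_iff_inter_open]
    rintro O hO ⟨x₀, hx₀⟩
    let G : Set (Ultrafilter Ω) := p ⁻¹' O ∩ {v | Y ∈ v}
    have hG : IsOpen G := (hO.preimage hpc).inter (ultrafilter_isOpen_basic Y)
    by_cases hne : (E ∩ G).Nonempty
    -- by minimality `E \ G` does not map onto `J → Bool`; over the open set that it misses, the
    -- section takes its values in `G`
    · obtain ⟨v, hvE, hvG⟩ := hne
      have h1 := hEmin (Subtype.val ⁻¹' Gᶜ) (fun h => by
        have : (⟨v, hvE⟩ : E) ∈ (Subtype.val ⁻¹' Gᶜ : Set E) := h ▸ Set.mem_univ _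
        exact this hvG) (hG.isClosed_compl.preimage continuous_subtype_val)
      have h2 : E.domRestrict p '' (Subtype.val ⁻¹' Gᶜ) = p '' (E ∩ Gᶜ) := by
        ext y; constructor
        · rintro ⟨⟨z, hz⟩, hzG, rfl⟩; exact ⟨z, ⟨hz, hzG⟩, rfl⟩
        · rintro ⟨z, ⟨hz, hzG⟩, rfl⟩; exact ⟨⟨z, hz⟩, hzG, rfl⟩
      rw [h2] at h1
      obtain ⟨y, hy⟩ := (Set.ne_univ_iff_exists_notMem _).1 h1
      have hcl : IsClosed (p '' (E ∩ Gᶜ)) :=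
        ((hEcl.inter hG.isClosed_compl).isCompact.image hpc).isClosed
      have hin : ∀ z ∉ p '' (E ∩ Gᶜ), σ z ∈ G := fun z hz => by
        by_contra h
        exact hz ⟨σ z, ⟨hσE z, h⟩, hσ z⟩
      refine ⟨y, ?_, Or.inl (mem_interior.2 ⟨_, fun z hz => (hin z hz).2, hcl.isOpen_compl, hy⟩)⟩
      have := (hin y hy).1
      rwa [Set.mem_preimage, hσ] at this
    · refine ⟨x₀, hx₀, Or.inr (mem_interior.2
        ⟨O, fun z hz hzY => hne ⟨σ z, hσE z, ?_, hzY⟩, hO, hx₀⟩)⟩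
      rw [Set.mem_preimage, hσ]
      exact hz

/-- Given independent sets `N j`, every point `x` of `J → Bool` has an ultrafilter `D x` that
contains `N j` exactly when `x j` holds, such that the membership of any fixed set in `D x` depends
on countably many coordinates of `x` only. It is the limit of the ultrafilters `σ (x + z)` of a
section `σ` as `z` tends to `0` along an ultrafilter that avoids every nowhere dense set; the
values of `σ` at `x` itself, which are not under control on the frontiers, then do not matter. -/
theorem exists_ultrafilter_countable_support {Ω J : Type u} (N : J → Set Ω)
    (hN : ∀ (x : J → Prop) (W : Finset J), ∃ c, ∀ j ∈ W, c ∈ N j ↔ x j) :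
    ∃ D : (J → Bool) → Ultrafilter Ω, (∀ x j, N j ∈ D x ↔ x j = true) ∧
      ∀ Y : Set Ω, ∃ w : Set J, w.Countable ∧
        ∀ x y, (∀ j ∈ w, x j = y j) → (Y ∈ D x ↔ Y ∈ D y) := by
  obtain ⟨σ, hσ, hY⟩ := exists_section N hN
  -- an ultrafilter that converges to `0` and contains every dense open set
  have hne : (𝓝 (fun _ : J => false) ⊓ residual (J → Bool)).NeBot := by
    rw [Filter.inf_neBot_iff]
    intro s hs t ht
    exact (dense_of_mem_residual ht).inter_nhds_nonempty hs |>.mono (by simp [Set.inter_comm])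
  let U : Ultrafilter (J → Bool) := Ultrafilter.of (𝓝 (fun _ : J => false) ⊓ residual (J → Bool))
  have hU : (U : Filter (J → Bool)) ≤ 𝓝 (fun _ : J => false) ⊓ residual (J → Bool) :=
    Ultrafilter.of_le _
  -- the translations of the group `(ℤ/2) ^ J`
  let tr : (J → Bool) → (J → Bool) → (J → Bool) := fun x z j => xor (x j) (z j)
  have htrc : ∀ x, Continuous (tr x) := fun x => continuous_pi fun j =>
    (continuous_of_discreteTopology (f := fun b => xor (x j) b)).comp (continuous_apply j)
  have htri : ∀ x z, tr x (tr x z) = z := fun x z => funext fun j => by simp [tr]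
  have htro : ∀ x, IsOpenMap (tr x) := fun x =>
    (Homeomorph.mk ⟨tr x, tr x, htri x, htri x⟩ (htrc x) (htrc x)).isOpenMap
  refine ⟨fun x => Ultrafilter.bind (U.map (tr x)) σ, fun x j => ?_, fun Y => ?_⟩
  · have h : N j ∈ Ultrafilter.bind (U.map (tr x)) σ ↔ {z | N j ∈ σ (tr x z)} ∈ U := Iff.rfl
    have hmem : {z : J → Bool | z j = false} ∈ U :=
      hU.trans inf_le_left
        (((isOpen_discrete {false}).preimage (continuous_apply j)).mem_nhds (Set.mem_singleton _))
    rw [h]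
    constructor
    · intro h'
      obtain ⟨z, hz, hz'⟩ := U.nonempty_of_mem (inter_mem h' hmem)
      have := (hσ _ j).1 hz
      have hz' : z j = false := hz'
      simpa [tr, hz'] using this
    · intro hx
      refine mem_of_superset hmem fun z hz => (hσ _ j).2 ?_
      have hz : z j = false := hz
      simp [tr, hz, hx]
  · obtain ⟨w, hw, A, B, hA, hB, hAS, hBS, hd, hAw, hBw⟩ := exists_countable_support (hY Y)
    refine ⟨w, hw, fun x y hxy => ?_⟩
    have h : ∀ x, Y ∈ Ultrafilter.bind (U.map (tr x)) σ ↔ {z | Y ∈ σ (tr x z)} ∈ U :=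
      fun x => Iff.rfl
    rw [h, h]
    have hG : tr x ⁻¹' (A ∪ B) ∈ (U : Filter (J → Bool)) :=
      hU.trans inf_le_right (residual_of_dense_open ((hA.union hB).preimage (htrc x))
        (hd.preimage (htro x)))
    have hag : ∀ z, ∀ j ∈ w, tr x z j = tr y z j := fun z j hj => by simp [tr, hxy j hj]
    refine Filter.congr_sets (mem_of_superset hG fun z hz => ?_)
    rcases hz with hz | hz
    · exact iff_of_true (hAS hz) (hAS (hAw _ _ (hag z) hz))
    · exact iff_of_false (hBS hz) (hBS (hBw _ _ (hag z) hz))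

end CantorCube

/-! ### Saturated models -/

section SaturatedModel

variable {L : FirstOrder.Language.{u, u}}

open FirstOrder.Language

/-- A saturated model realizes every finitely satisfiable set of formulas in one variable over
fewer than `#M` parameters. -/
theorem IsSaturated.exists_realize {M : Type u} [L.Structure M] [Nonempty M]
    (hM : IsSaturated L M) {ι : Type u} (g : ι → M) (hι : #ι < #M)
    (S : Set (L.Formula (ι ⊕ Fin 1)))
    (hS : ∀ S₀ : Finset (L.Formula (ι ⊕ Fin 1)), (S₀ : Set _) ⊆ S →
      ∃ x : Fin 1 → M, ∀ ψ ∈ S₀, ψ.Realize (Sum.elim g x)) :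
    ∃ x : Fin 1 → M, ∀ ψ ∈ S, ψ.Realize (Sum.elim g x) := by
  classical
  let A : Set M := Set.range g
  let r : ι → A := Set.rangeFactorization g
  let c : L.Formula (ι ⊕ Fin 1) → L[[A]].Formula (Fin 1) := fun ψ =>
    BoundedFormula.constantsVarsEquiv.symm (ψ.relabel (Sum.map r id))
  have hc : ∀ ψ (x : Fin 1 → M), (c ψ).Realize x ↔ ψ.Realize (Sum.elim g x) := by
    intro ψ x
    have h1 := BoundedFormula.realize_constantsVarsEquiv (L := L) (α := A) (M := M)
      (φ := c ψ) (v := x) (xs := default)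
    have h2 : BoundedFormula.constantsVarsEquiv (c ψ) = ψ.relabel (Sum.map r id) :=
      Equiv.apply_symm_apply _ _
    rw [h2] at h1
    refine h1.symm.trans ?_
    have h3 := Formula.realize_relabel (φ := ψ) (g := Sum.map r id)
      (v := Sum.elim (fun a : A => ((L.con a : M))) x)
    refine h3.trans ?_
    have h4 : (Sum.elim (fun a : A => ((L.con a : M))) x) ∘ Sum.map r id = Sum.elim g x := by
      funext z
      rcases z with z | z
      · change ((L.con (r z) : M)) = g z
        rfl
      · rfl
    rw [h4]
  let T : L[[A]].Theory := L[[A]].completeTheory M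
  let S' : L[[A]][[Fin 1]].Theory := (fun ψ => Formula.equivSentence (c ψ)) '' S
  have hsat : ((L[[A]].lhomWithConstants (Fin 1)).onTheory T ∪ S').IsSatisfiable := by
    rw [Theory.isSatisfiable_iff_isFinitelySatisfiable]
    intro T₀ hT₀
    obtain ⟨S₀, hS₀, hS₀'⟩ : ∃ S₀ : Finset (L.Formula (ι ⊕ Fin 1)), (S₀ : Set _) ⊆ S ∧
        ∀ θ ∈ T₀, θ ∈ S' → ∃ ψ ∈ S₀, Formula.equivSentence (c ψ) = θ := by
      have : ∀ θ : L[[A]][[Fin 1]].Sentence, θ ∈ S' → ∃ ψ ∈ S, Formula.equivSentence (c ψ) = θ :=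
        fun θ h => h
      choose f hf hf' using this
      refine ⟨(T₀.filter (· ∈ S')).attach.image fun θ => f θ.1 (Finset.mem_filter.1 θ.2).2, ?_, ?_⟩
      · intro ψ hψ
        simp only [Finset.coe_image, Set.mem_image] at hψ
        obtain ⟨θ, _, rfl⟩ := hψ
        exact hf _ _
      · intro θ hθ hθ'
        exact ⟨f θ hθ', Finset.mem_image.2
          ⟨⟨θ, Finset.mem_filter.2 ⟨hθ, hθ'⟩⟩, Finset.mem_attach _ _, rfl⟩, hf' _ _⟩
    obtain ⟨x, hx⟩ := hS S₀ hS₀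
    let : (constantsOn (Fin 1)).Structure M := constantsOn.structure x
    suffices hmod : M ⊨ (T₀ : L[[A]][[Fin 1]].Theory) from Theory.Model.isSatisfiable M
    refine ⟨fun θ hθ => ?_⟩
    rcases hT₀ hθ with h | h
    · have hm : M ⊨ (L[[A]].lhomWithConstants (Fin 1)).onTheory T :=
        (LHom.onTheory_model _ T).2 inferInstance
      exact hm.realize_of_mem _ h
    · obtain ⟨ψ, hψ, rfl⟩ := hS₀' θ hθ h
      rw [Formula.realize_equivSentence]
      exact (hc ψ x).2 (hx ψ hψ)
  have hne : {p : T.CompleteType (Fin 1) | S' ⊆ ↑p}.Nonempty := by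
    rw [Set.nonempty_iff_ne_empty]
    intro h
    exact (Theory.CompleteType.setOfPred_subset_eq_empty_iff _).1 h hsat
  obtain ⟨p, hp⟩ := hne
  obtain ⟨x, hx⟩ := hM A (Cardinal.mk_range_le.trans_lt hι) p
  refine ⟨x, fun ψ hψ => (hc ψ x).1 ?_⟩
  have : Formula.equivSentence (c ψ) ∈ p := hp ⟨ψ, hψ, rfl⟩
  rw [← hx] at this
  exact Theory.CompleteType.formula_mem_typeOf.1 this

/-- The families `f` in `N` and `g` in `M` have the same complete type. -/
def SameType (L : FirstOrder.Language.{u, u}) {ι N M : Type u} [L.Structure N] [L.Structure M]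
    (f : ι → N) (g : ι → M) : Prop :=
  ∀ ψ : L.Formula ι, ψ.Realize f ↔ ψ.Realize g

section SameType

variable {N M : Type u} [L.Structure N] [L.Structure M]

theorem SameType.comp {ι κ : Type u} {f : ι → N} {g : ι → M} (h : SameType L f g) (r : κ → ι) :
    SameType L (f ∘ r) (g ∘ r) := fun ψ => by
  rw [← Formula.realize_relabel, ← Formula.realize_relabel]
  exact h _

theorem SameType.eq_iff {ι : Type u} {f : ι → N} {g : ι → M} (h : SameType L f g) (i j : ι) :
    f i = f j ↔ g i = g j := by
  have := h (Term.equal (Term.var i) (Term.var j))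
  simpa [Formula.realize_equal] using this

/-- One step of the extension of a partial elementary map into a saturated model. -/
theorem SameType.exists_extend_one [Nonempty M] (hM : IsSaturated L M) {ι : Type u} {f : ι → N}
    {g : ι → M} (h : SameType L f g) (hι : #ι < #M) (a : N) :
    ∃ b : M, ∀ ψ : L.Formula (ι ⊕ Fin 1),
      ψ.Realize (Sum.elim f fun _ => a) ↔ ψ.Realize (Sum.elim g fun _ => b) := by
  obtain ⟨x, hx⟩ := hM.exists_realize g hι {ψ | ψ.Realize (Sum.elim f fun _ => a)} (by
    intro S₀ hS₀
    have h1 : (Formula.iExs (Fin 1) (Formula.iInf fun ψ : S₀ => ψ.1)).Realize f := by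
      rw [Formula.realize_iExs]
      refine ⟨fun _ => a, ?_⟩
      rw [Formula.realize_iInf]
      exact fun ψ => hS₀ ψ.2
    rw [h, Formula.realize_iExs] at h1
    obtain ⟨x, hx⟩ := h1
    rw [Formula.realize_iInf] at hx
    exact ⟨x, fun ψ hψ => hx ⟨ψ, hψ⟩⟩)
  have hx0 : x = fun _ => x 0 := funext fun i => by rw [Subsingleton.elim i 0]
  refine ⟨x 0, fun ψ => ⟨fun hψ => ?_, fun hψ => ?_⟩⟩
  · rw [← hx0]; exact hx ψ hψ
  · by_contra hcon
    have := hx ψ.not hcon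
    rw [hx0] at this
    exact this hψ

/-- A saturated model `M` is universal over small subsets: if `f` and `g` have the same type, then
any further family `h` in `N` of fewer than `#M` elements has a counterpart in `M`. The proof
extends partial elementary maps by Zorn's lemma. -/
theorem SameType.exists_extend [Nonempty M] (hM : IsSaturated L M) (hinf : ℵ₀ ≤ #M)
    {ι κ : Type u} {f : ι → N} {g : ι → M} (hfg : SameType L f g) (hι : #ι < #M) (hκ : #κ < #M)
    (h : κ → N) : ∃ h' : κ → M, SameType L (Sum.elim f h) (Sum.elim g h') := by
  classical
  -- `G` is the graph of a partial choice of the counterparts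
  let P : Set (κ × M) → Prop := fun G => SameType L (ι := ι ⊕ G) (Sum.elim f fun p => h p.1.1)
    (Sum.elim g fun p => p.1.2)
  obtain ⟨G, hG⟩ := zorn_subset {G | P G} (by
    intro ch hch hchain
    by_cases hne : ch.Nonempty
    · refine ⟨⋃₀ ch, fun ψ => ?_, fun s hs => Set.subset_sUnion_of_mem hs⟩
      have hfin : ∃ C ∈ ch, ∀ v ∈ ψ.freeVarFinset, ∀ p, v = Sum.inr p → p.1 ∈ C := by
        have : ∀ V : Finset (ι ⊕ ↥(⋃₀ ch)), ∃ C ∈ ch, ∀ v ∈ V, ∀ p, v = Sum.inr p → p.1 ∈ C := by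
          intro V
          induction V using Finset.induction_on with
          | empty =>
            obtain ⟨C, hC⟩ := hne
            exact ⟨C, hC, by simp⟩
          | insert v V hv ih =>
            obtain ⟨C, hC, hV⟩ := ih
            rcases v with i | p
            · refine ⟨C, hC, fun v hv p hp => ?_⟩
              rcases Finset.mem_insert.1 hv with rfl | hv
              · exact absurd hp (by simp)
              · exact hV v hv p hp
            · obtain ⟨C', hC', hp'⟩ := p.2
              obtain ⟨C'', hC'', h1, h2⟩ := hchain.directedOn C hC C' hC'
              refine ⟨C'', hC'', fun v hv q hq => ?_⟩
              rcases Finset.mem_insert.1 hv with rfl | hv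
              · rw [← Sum.inr.inj hq]; exact h2 hp'
              · exact h1 (hV v hv q hq)
        exact this _
      obtain ⟨C, hC, hV⟩ := hfin
      let r : ψ.freeVarFinset → ι ⊕ C := fun v =>
        match v with
        | ⟨Sum.inl i, _⟩ => Sum.inl i
        | ⟨Sum.inr p, hv⟩ => Sum.inr ⟨p.1, hV _ hv p rfl⟩
      have key := hch hC (ψ.restrictFreeVar r)
      refine Iff.trans ?_ (key.trans ?_)
      · refine (BoundedFormula.realize_restrictFreeVar _ ?_).symm
        rintro ⟨i | p, hv⟩ <;> rfl
      · refine BoundedFormula.realize_restrictFreeVar _ ?_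
        rintro ⟨i | p, hv⟩ <;> rfl
    · rw [Set.not_nonempty_iff_eq_empty] at hne
      subst hne
      refine ⟨∅, fun ψ => ?_, by simp⟩
      have : SameType L (ι := ι ⊕ (∅ : Set (κ × M))) (Sum.elim f fun p => h p.1.1)
          (Sum.elim g fun p => p.1.2) := by
        have := hfg.comp (κ := ι ⊕ (∅ : Set (κ × M))) (Sum.elim id fun p => p.2.elim)
        convert this using 1
        · funext z; rcases z with z | z
          · rfl
          · exact z.2.elim
        · funext z; rcases z with z | z
          · rfl
          · exact z.2.elim
      exact this ψ)
  have hP : P G := hG.prop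
  have hfun : ∀ k x y, (k, x) ∈ G → (k, y) ∈ G → x = y := fun k x y hx hy =>
    (hP.eq_iff (Sum.inr ⟨_, hx⟩) (Sum.inr ⟨_, hy⟩)).1 rfl
  have hGcard : #G ≤ #κ := Cardinal.mk_le_of_injective (f := fun p : G => p.1.1) (by
    rintro ⟨⟨k, x⟩, hx⟩ ⟨⟨k', y⟩, hy⟩ (rfl : k = k')
    rw [Subtype.mk.injEq, hfun k x y hx hy])
  have htot : ∀ k, ∃ x, (k, x) ∈ G := by
    intro k
    obtain ⟨b, hb⟩ := hP.exists_extend_one hM (by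
      rw [Cardinal.mk_sum, Cardinal.lift_id, Cardinal.lift_id]
      exact Cardinal.add_lt_of_lt hinf hι (hGcard.trans_lt hκ)) (h k)
    have hins : P (insert (k, b) G) := by
      intro ψ
      let r : ι ⊕ ↥(insert (k, b) G) → (ι ⊕ G) ⊕ Fin 1 := Sum.elim (Sum.inl ∘ Sum.inl) fun p =>
        if hp : p.1 ∈ G then Sum.inl (Sum.inr ⟨p.1, hp⟩) else Sum.inr 0
      have key := hb (ψ.relabel r)
      rw [Formula.realize_relabel, Formula.realize_relabel] at key
      convert key using 2
      · funext z
        rcases z with z | z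
        · rfl
        · by_cases hp : z.1 ∈ G
          · simp [r, hp]
          · have : z.1 = (k, b) := (Set.mem_insert_iff.1 z.2).resolve_right hp
            have hr : r (Sum.inr z) = Sum.inr 0 := dif_neg hp
            rw [Function.comp_apply, hr]
            exact congrArg (fun q : κ × M => h q.1) this
      · funext z
        rcases z with z | z
        · rfl
        · by_cases hp : z.1 ∈ G
          · simp [r, hp]
          · have : z.1 = (k, b) := (Set.mem_insert_iff.1 z.2).resolve_right hp
            have hr : r (Sum.inr z) = Sum.inr 0 := dif_neg hp
            rw [Function.comp_apply, hr]
            exact congrArg (fun q : κ × M => q.2) this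
    exact ⟨b, hG.le_of_ge hins (Set.subset_insert _ _) (Set.mem_insert _ _)⟩
  choose h' hh' using htot
  refine ⟨h', ?_⟩
  have := hP.comp (κ := ι ⊕ κ) (Sum.elim Sum.inl fun k => Sum.inr ⟨(k, h' k), hh' k⟩)
  convert this using 1
  · funext z; rcases z with z | z <;> rfl
  · funext z; rcases z with z | z <;> rfl

end SameType

section Ultraproduct

open Filter

variable {M : Type u} [L.Structure M] [Nonempty M]

/-- Saturation realizes the average of an ultrafilter: for an ultrafilter `D` on the `m`-tuples
of the model, some tuple satisfies over a small set of parameters what `D`-almost all tuples satisfy. -/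
theorem IsSaturated.exists_average (hM : IsSaturated L M) (hinf : ℵ₀ ≤ #M) {m k : ℕ}
    (φ : L.Formula (Fin m ⊕ Fin k)) (s : Set M) (hs : #s < #M) (D : Ultrafilter (Fin m → M)) :
    ∃ a : Fin m → M, ∀ b : Fin k → M, (∀ j, b j ∈ s) →
      (φ.Realize (Sum.elim a b) ↔ {c | φ.Realize (Sum.elim c b)} ∈ D) := by
  let N := (D : Filter (Fin m → M)).Product fun _ => M
  -- the diagonal embedding into the ultrapower is elementary
  let dg : M → N := fun x => ((fun _ => x : (Fin m → M) → M) : N)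
  have hdg : SameType L (fun x : s => dg x) (fun x : s => (x : M)) := by
    intro ψ
    refine (Ultraproduct.realize_formula_cast (M := fun _ : Fin m → M => M) (u := D) ψ
      (fun (x : s) _ => (x : M))).trans ?_
    exact Filter.eventually_const
  have hm : #(ULift.{u} (Fin m)) < #M := by
    refine lt_of_lt_of_le ?_ hinf
    simp [Cardinal.natCast_lt_aleph0]
  obtain ⟨a, ha⟩ := hdg.exists_extend hM hinf hs hm
    (fun i => ((fun c => c i.down : (Fin m → M) → M) : N))
  refine ⟨fun i => a ⟨i⟩, fun b hb => ?_⟩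
  let r : Fin m ⊕ Fin k → s ⊕ ULift.{u} (Fin m) :=
    Sum.elim (fun i => Sum.inr ⟨i⟩) fun j => Sum.inl ⟨b j, hb j⟩
  have key := ha (φ.relabel r)
  rw [Formula.realize_relabel, Formula.realize_relabel] at key
  have h1 : (Sum.elim (fun x : s => (x : M)) a) ∘ r = Sum.elim (fun i => a ⟨i⟩) b := by
    funext z; rcases z with z | z <;> rfl
  rw [h1] at key
  refine key.symm.trans ?_
  have h2 := Ultraproduct.realize_formula_cast (M := fun _ : Fin m → M => M) (u := D) φ
      (fun z c => Sum.elim c b z)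
  have h3 : (Sum.elim (fun x : s => dg x)
      (fun i : ULift.{u} (Fin m) => ((fun c => c i.down : (Fin m → M) → M) : N))) ∘ r =
      fun z => ((fun c => Sum.elim c b z : (Fin m → M) → M) : N) := by
    funext z; rcases z with z | z <;> rfl
  rw [h3]
  exact h2

/-- In a saturated model of cardinality above `lam`, a formula with the independence property
represents every relation between index sets of size at most `lam`. The finite patterns are
glued in an ultrapower, which then is embedded. -/
theorem IsSaturated.exists_represents {T : L.Theory} (hT : M ⊨ T) (hM : IsSaturated L M)
    {lam : Cardinal.{u}} (hlam : ℵ₀ ≤ lam) (hcard : lam < #M) {m k : ℕ}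
    {φ : L.Formula (Fin m ⊕ Fin k)} (hφ : FormulaHasIP T φ) (I J : Type u) (hI : #I ≤ lam)
    (hJ : #J ≤ lam) (R : I → J → Prop) :
    ∃ (a : I → Fin m → M) (b : J → Fin k → M),
      ∀ i j, φ.Realize (Sum.elim (a i) (b j)) ↔ R i j := by
  classical
  have hfin : ∀ W : Finset J, ∃ b : J → Fin k → M, ∀ s : Set J, ∃ a : Fin m → M, ∀ j ∈ W,
      φ.Realize (Sum.elim a (b j)) ↔ j ∈ s := by
    intro W
    obtain ⟨b, hb⟩ : ∃ b : Fin W.card → Fin k → M, ∀ s : Set (Fin W.card), ∃ a : Fin m → M,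
      ∀ i, φ.Realize (Sum.elim a (b i)) ↔ i ∈ s := hφ (Theory.ModelType.of T M) W.card
    refine ⟨fun j => if h : j ∈ W then b (W.equivFin ⟨j, h⟩) else fun _ => Classical.arbitrary M,
      fun s => ?_⟩
    obtain ⟨a, ha⟩ := hb {i | (W.equivFin.symm i : J) ∈ s}
    refine ⟨a, fun j hj => ?_⟩
    simp only [dif_pos hj]
    refine (ha _).trans ?_
    simp
  choose b hb using hfin
  choose a ha using hb
  -- in the ultrapower along finer and finer finite subsets of `J`, all of `R` is represented
  let D : Ultrafilter (Finset J) := Ultrafilter.of atTop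
  have hD : ∀ j, {W : Finset J | j ∈ W} ∈ D := fun j =>
    Ultrafilter.of_le _ (mem_of_superset (mem_atTop {j}) fun W hW => by simpa using hW)
  let N := (D : Filter (Finset J)).Product fun _ => M
  let K := (I × Fin m) ⊕ (J × Fin k)
  let q : K → Finset J → M := Sum.elim (fun p W => a W {j | R p.1 j} p.2) fun p W => b W p.1 p.2
  have hemp : SameType L (fun x : PEmpty.{u + 1} => (x.elim : N))
      (fun x : PEmpty.{u + 1} => (x.elim : M)) := by
    intro ψ
    have h1 := Ultraproduct.realize_formula_cast (M := fun _ : Finset J => M) (u := D) ψ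
      (fun x => x.elim)
    have h2 : (fun x : PEmpty.{u + 1} => (x.elim : N)) = fun x =>
      (((x.elim : Finset J → M)) : N) := funext fun x => x.elim
    rw [h2]
    refine h1.trans ?_
    have h3 : ∀ W : Finset J, (fun i : PEmpty.{u + 1} => (i.elim : Finset J → M) W) =
      fun x => x.elim := fun W => funext fun x => x.elim
    simp only [h3]
    exact Filter.eventually_const
  have hprod : ∀ (A : Type u) (n : ℕ), #A ≤ lam → #(A × Fin n) ≤ lam := by
    intro A n hA
    rw [Cardinal.mk_prod, Cardinal.lift_uzero, Cardinal.mk_fin, Cardinal.lift_natCast]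
    exact Cardinal.mul_le_of_le hlam hA ((Cardinal.natCast_lt_aleph0).le.trans hlam)
  have hK : #K < #M := by
    refine lt_of_le_of_lt ?_ hcard
    rw [Cardinal.mk_sum, Cardinal.lift_id, Cardinal.lift_id]
    exact Cardinal.add_le_of_le hlam (hprod I m hI) (hprod J k hJ)
  have hinf : ℵ₀ ≤ #M := hlam.trans hcard.le
  obtain ⟨c, hc⟩ := hemp.exists_extend hM hinf (by simp; exact hcard.pos) hK
    (fun p => (q p : N))
  refine ⟨fun i x => c (Sum.inl (i, x)), fun j x => c (Sum.inr (j, x)), fun i j => ?_⟩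
  let r : Fin m ⊕ Fin k → PEmpty.{u + 1} ⊕ K :=
    Sum.elim (fun x => Sum.inr (Sum.inl (i, x))) fun x => Sum.inr (Sum.inr (j, x))
  have key := hc (φ.relabel r)
  rw [Formula.realize_relabel, Formula.realize_relabel] at key
  have h1 : (Sum.elim (fun x : PEmpty.{u + 1} => (x.elim : M)) c) ∘ r =
      Sum.elim (fun x => c (Sum.inl (i, x))) fun x => c (Sum.inr (j, x)) := by
    funext z; rcases z with z | z <;> rfl
  rw [h1] at key
  refine key.symm.trans ?_
  have h2 : (Sum.elim (fun x : PEmpty.{u + 1} => (x.elim : N)) (fun p => (q p : N))) ∘ r =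
      fun z => ((fun W => Sum.elim (a W {j | R i j}) (b W j) z : Finset J → M) : N) := by
    funext z; rcases z with z | z <;> rfl
  rw [h2]
  refine (Ultraproduct.realize_formula_cast (M := fun _ : Finset J => M) (u := D) φ
      (fun z W => Sum.elim (a W {j | R i j}) (b W j) z)).trans ?_
  have h3 : ∀ᶠ W in (D : Filter (Finset J)),
      (φ.Realize (fun z => Sum.elim (a W {j | R i j}) (b W j) z) ↔ R i j) :=
    mem_of_superset (hD j) fun W hW => ha W _ j hW
  rw [Filter.eventually_congr h3]
  exact Filter.eventually_const

end Ultraproduct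

end SaturatedModel

/-! ### Clubs and cofinality -/

section Club

variable {c : Cardinal.{u}}

/-- In a regular cardinal, small families are strictly bounded. -/
theorem exists_forall_lt_of_card_lt (hc : c.IsRegular) {ι : Type v} (f : ι → Iio c.ord)
    (hι : lift.{u} #ι < lift.{v} c) : ∃ b, ∀ i, f i < b := by
  have hlt : ⨆ i, (f i : Ordinal) + 1 < c.ord :=
    Ordinal.lift_iSup_add_one_lt_of_lt_cof (by rwa [← Ordinal.lift_cof, hc.cof_ord])
      fun i => (f i).2
  refine ⟨⟨_, hlt⟩, fun i => ?_⟩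
  change (f i : Ordinal) < ⨆ i, (f i : Ordinal) + 1
  have hb : BddAbove (Set.range fun i => (f i : Ordinal) + 1) :=
    ⟨c.ord, by rintro _ ⟨i, rfl⟩; exact Order.add_one_le_of_lt (f i).2⟩
  exact (lt_add_one _).trans_le (le_ciSup hb i)

theorem exists_forall_lt_of_mk_lt (hc : c.IsRegular) {ι : Type (u + 1)} (f : ι → Iio c.ord)
    (hι : #ι < lift.{u + 1} c) : ∃ b, ∀ i, f i < b :=
  exists_forall_lt_of_card_lt hc f (by rwa [Cardinal.lift_id'.{u, u + 1}])

theorem exists_isLUB_of_forall_lt {α : Type*} [LinearOrder α] [WellFoundedLT α] {s : Set α} {b : α}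
    (h : ∀ x ∈ s, x ≤ b) : ∃ δ, IsLUB s δ := by
  have hne : (upperBounds s).Nonempty := ⟨b, h⟩
  exact ⟨wellFounded_lt.min _ hne, wellFounded_lt.min_mem _ hne,
    fun x hx => not_lt.1 fun hlt => wellFounded_lt.not_lt_min _ hx hlt⟩

theorem mk_Iio_lt (δ : Iio c.ord) : #(Iio (δ : Ordinal)) < lift.{u + 1} c := by
  rw [Cardinal.mk_Iio_ordinal, Cardinal.lift_lt]
  exact lt_ord.1 δ.2

theorem mk_Iio_ord (c : Cardinal.{u}) : #(Iio c.ord) = lift.{u + 1} c := by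
  rw [Cardinal.mk_Iio_ordinal, card_ord]

theorem mk_subtype_le_lt (hc : ℵ₀ ≤ c) (δ : Iio c.ord) :
    #{x : Iio c.ord // x ≤ δ} < lift.{u + 1} c := by
  have hs : Order.succ (δ : Ordinal) < c.ord := (isSuccLimit_ord hc).succ_lt δ.2
  refine lt_of_le_of_lt ?_ (mk_Iio_lt ⟨_, hs⟩)
  exact Cardinal.mk_le_of_injective
    (f := fun x => ⟨x.1.1, Order.lt_succ_of_le (a := x.1.1) (b := δ.1) x.2⟩) fun x y h => Subtype.ext (Subtype.ext (congrArg (fun z => z.1) h))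

theorem cof_Iio_ord_ne_aleph0 {c : Cardinal.{u}} (hc : c.IsRegular) (hunc : ℵ₀ < c) :
    Order.cof (Iio c.ord) ≠ ℵ₀ := by
  rw [Ordinal.cof_Iio, ← Ordinal.lift_cof, hc.cof_ord, ← Cardinal.lift_aleph0.{u + 1, u}]
  exact fun h => hunc.ne' (Cardinal.lift_injective h)

/-- Below a regular uncountable cardinal, the points closed under a function form a club. -/
theorem isClub_setOf_forall_lt (hc : c.IsRegular) (hunc : ℵ₀ < c) (f : Iio c.ord → Iio c.ord) :
    IsClub {δ | ∀ β < δ, f β < δ} := by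
  refine ⟨fun d hd _ _ a ha β hβ => ?_, fun x => ?_⟩
  · obtain ⟨y, hy, hβy⟩ := (lt_isLUB_iff ha).1 hβ
    exact (hd hy β hβy).trans_le (ha.1 hy)
  · have hF : ∀ y, ∃ z, ∀ β ≤ y, β < z ∧ f β < z := by
      intro y
      have hcard : lift.{u} #{x : Iio c.ord // x ≤ y} < lift.{u + 1} c := by
        rw [Cardinal.lift_id'.{u, u + 1}]
        exact mk_subtype_le_lt hc.aleph0_le y
      obtain ⟨z, hz⟩ := exists_forall_lt_of_card_lt hc
        (fun p : {x : Iio c.ord // x ≤ y} => max p.1 (f p.1)) hcard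
      exact ⟨z, fun β hβ => max_lt_iff.1 (hz ⟨β, hβ⟩)⟩
    choose F hF using hF
    let s : ℕ → Iio c.ord := fun n => F^[n] x
    have hs : ∀ n, s (n + 1) = F (s n) := fun n => Function.iterate_succ_apply' F n x
    obtain ⟨b, hb⟩ := exists_forall_lt_of_card_lt hc s (by simpa using hunc)
    obtain ⟨δ, hδ⟩ := exists_isLUB_of_forall_lt (s := Set.range s) (b := b)
      (by rintro _ ⟨n, rfl⟩; exact (hb n).le)
    refine ⟨δ, fun β hβ => ?_, hδ.1 ⟨0, rfl⟩⟩
    obtain ⟨_, ⟨n, rfl⟩, hn⟩ := (lt_isLUB_iff hδ).1 hβ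
    refine ((hF (s n) β hn.le).2).trans_le ?_
    rw [← hs]
    exact hδ.1 ⟨n + 1, rfl⟩

/-- A club contains suprema of strictly increasing sequences of any smaller length. -/
theorem exists_mem_isLUB_strictMono (hc : c.IsRegular) {C : Set (Iio c.ord)} (hC : IsClub C)
    {θ : Cardinal.{u}} (hθ0 : θ ≠ 0) (hθ : θ < c) (x : Iio c.ord) :
    ∃ f : Iio θ.ord → Iio c.ord, StrictMono f ∧ (∀ i, x < f i) ∧
      ∃ δ ∈ C, IsLUB (Set.range f) δ := by
  have hlift : ∀ {ι : Type (u + 1)}, #ι < lift.{u + 1} c → lift.{u} #ι < lift.{u + 1} c := by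
    intro ι h
    rwa [Cardinal.lift_id'.{u, u + 1}]
  have hsmall : ∀ i : Iio θ.ord, #{j : Iio θ.ord // j < i} < lift.{u + 1} c := fun i =>
    (Cardinal.mk_subtype_le _).trans_lt (by rw [mk_Iio_ord]; exact Cardinal.lift_lt.2 hθ)
  have hstep : ∀ (i : Iio θ.ord) (g : ∀ j, j < i → Iio c.ord),
      ∃ z ∈ C, x < z ∧ ∀ j (h : j < i), g j h < z := by
    intro i g
    obtain ⟨b, hb⟩ := exists_forall_lt_of_card_lt hc
      (fun j : {j : Iio θ.ord // j < i} => g j.1 j.2) (hlift (hsmall i))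
    obtain ⟨b', hb'⟩ := exists_forall_lt_of_card_lt hc (fun _ : Unit => max x b) (by
      simpa using Cardinal.one_lt_aleph0.trans_le hc.aleph0_le)
    obtain ⟨z, hz, hbz⟩ := hC.isCofinal b'
    exact ⟨z, hz, (le_max_left x b).trans_lt ((hb' ()).trans_le hbz),
      fun j h => (hb ⟨j, h⟩).trans_le ((le_max_right x b).trans ((hb' ()).le.trans hbz))⟩
  choose G hGC hGx hG using hstep
  let f : Iio θ.ord → Iio c.ord := wellFounded_lt.fix G
  have hf : ∀ i, f i = G i fun j _ => f j := fun i => wellFounded_lt.fix_eq G i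
  have hmem : ∀ i, f i ∈ C := fun i => by rw [hf]; exact hGC _ _
  refine ⟨f, fun j i hji => ?_, fun i => ?_, ?_⟩
  · rw [hf i]; exact hG i _ j hji
  · rw [hf i]; exact hGx _ _
  · obtain ⟨b, hb⟩ := exists_forall_lt_of_card_lt hc f
      (hlift (by rw [mk_Iio_ord]; exact Cardinal.lift_lt.2 hθ))
    obtain ⟨δ, hδ⟩ := exists_isLUB_of_forall_lt (s := Set.range f) (b := b)
      (by rintro _ ⟨n, rfl⟩; exact (hb n).le)
    have : (Set.range f).Nonempty :=
      ⟨f ⟨0, lt_ord.2 (by rw [Ordinal.card_zero]; exact pos_iff_ne_zero.2 hθ0)⟩, Set.mem_range_self _⟩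
    exact ⟨δ, hC.isLUB_mem (by rintro _ ⟨i, rfl⟩; exact hmem i) this hδ, hδ⟩

theorem cof_eq_of_isLUB_strictMono {θ : Cardinal.{u}} (hθ : θ.IsRegular)
    {f : Iio θ.ord → Iio c.ord} (hf : StrictMono f) {δ : Iio c.ord} (hδ : IsLUB (Set.range f) δ) :
    (δ : Ordinal).cof = θ := by
  have h1 := Ordinal.cof_iSup_Iio (f := fun i => (f i : Ordinal)) (fun i j h => hf h)
    (isSuccLimit_ord hθ.aleph0_le).isSuccPrelimit
  have h2 : ⨆ i, (f i : Ordinal) = δ := by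
    have : Nonempty (Iio θ.ord) := ⟨⟨0, hθ.ord_pos⟩⟩
    have hb : BddAbove (Set.range fun i => (f i : Ordinal)) :=
      ⟨δ, by rintro _ ⟨i, rfl⟩; exact hδ.1 ⟨i, rfl⟩⟩
    refine le_antisymm (ciSup_le fun i => hδ.1 ⟨i, rfl⟩) (not_lt.1 fun hlt => ?_)
    obtain ⟨_, ⟨i, rfl⟩, hi⟩ := (lt_isLUB_iff hδ (b := ⟨_, hlt.trans δ.2⟩)).1 hlt
    exact (le_ciSup hb i).not_gt hi
  rw [← h2, h1, hθ.cof_ord]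

theorem exists_eventually_ge_of_cof {δ : Ordinal.{u}} {θ : Cardinal.{u}} (hδ : δ.cof = θ) :
    ∃ f : Iio θ.ord → Iio δ, ∀ β : Iio δ, ∃ i₀, ∀ i, i₀ ≤ i → β ≤ f i := by
  obtain ⟨f, hf⟩ := Ordinal.exists_isFundamentalSeq (o := δ) (a := θ.ord) (by rw [hδ])
  refine ⟨f, fun β => ?_⟩
  obtain ⟨_, ⟨i, rfl⟩, hi⟩ := hf.isCofinal_range β
  exact ⟨i, fun j hj => hi.trans (hf.strictMono.monotone hj)⟩

end Club

/-! ### Separated families of sets below a strong limit cardinal -/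

section SeparatedFamily

variable {lam : Cardinal.{u}}

/-- For `lam` a strong limit, there are at most `lam` bounded subsets of `lam`. -/
theorem mk_sigma_set_Iio_le (hlam : ℵ₀ ≤ lam) (hlim : ∀ μ < lam, 2 ^ μ < lam) :
    #(Σ δ : Iio lam.ord, Set (Iio (δ : Ordinal.{u}))) ≤ lift.{u + 1} lam := by
  rw [Cardinal.mk_sigma]
  refine (Cardinal.sum_le_sum _ (fun _ => lift.{u + 1} lam) fun δ => ?_).trans ?_
  · rw [Cardinal.mk_set, Cardinal.mk_Iio_ordinal, ← Cardinal.lift_two_power, Cardinal.lift_le]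
    exact (hlim _ (lt_ord.1 δ.2)).le
  · rw [Cardinal.sum_const', mk_Iio_ord]
    exact Cardinal.mul_le_of_le (by simpa using hlam) le_rfl le_rfl

/-- A club contains points of cofinality `ω₁` above every `x`. Such a point `δ` has a cofinal
subset `R` of order type `ω₁`, and countable sets below `δ` are bounded below `δ`. -/
theorem exists_mem_club_cof_omega_one (hreg : lam.IsRegular) (hlam : ℵ₁ < lam)
    {C : Set (Iio lam.ord)} (hC : IsClub C) (x : Iio lam.ord) :
    ∃ δ ∈ C, x < δ ∧ (∃ R : Set (Iio lam.ord), R ⊆ Iio δ ∧ (∀ β < δ, ∃ r ∈ R, β < r) ∧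
        ∀ β < δ, (R ∩ Iio β).Countable) ∧
      ∀ s : Set (Iio lam.ord), s.Countable → s ⊆ Iio δ → ∃ ξ < δ, ∀ y ∈ s, y < ξ := by
  obtain ⟨f, hf, hx, δ, hδC, hδ⟩ :=
    exists_mem_isLUB_strictMono hreg hC (θ := ℵ₁) (aleph_pos 1).ne' hlam x
  have hlim : ∀ i : Iio (ℵ₁ : Cardinal.{u}).ord, ∃ j, i < j := fun i =>
    ⟨⟨Order.succ (i : Ordinal), (isSuccLimit_ord isRegular_aleph_one.aleph0_le).succ_lt i.2⟩,
      Order.lt_succ (i : Ordinal)⟩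
  have hlt : ∀ i, f i < δ := fun i => by
    obtain ⟨j, hj⟩ := hlim i
    exact (hf hj).trans_le (hδ.1 ⟨j, rfl⟩)
  have hlub : ∀ β < δ, ∃ i, β < f i := fun β hβ => by
    obtain ⟨_, ⟨i, rfl⟩, hi⟩ := (lt_isLUB_iff hδ).1 hβ
    exact ⟨i, hi⟩
  refine ⟨δ, hδC, ?_, ⟨Set.range f, ?_, ?_, ?_⟩, ?_⟩
  · exact (hx ⟨0, isRegular_aleph_one.ord_pos⟩).trans (hlt _)
  · rintro _ ⟨i, rfl⟩; exact hlt i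
  · intro β hβ
    obtain ⟨i, hi⟩ := hlub β hβ
    exact ⟨_, ⟨i, rfl⟩, hi⟩
  · intro β hβ
    obtain ⟨i, hi⟩ := hlub β hβ
    have hcount : (Iio i).Countable := by
      rw [← Cardinal.le_aleph0_iff_set_countable]
      have h1 : #(Iio i) ≤ #(Iio (i : Ordinal.{u})) :=
        Cardinal.mk_le_of_injective (f := fun y => ⟨y.1.1, y.2⟩)
          fun y z h => Subtype.ext (Subtype.ext (congrArg (fun t => t.1) h))
      have h2 : #(Iio (i : Ordinal.{u})) < lift.{u + 1} (ℵ₁ : Cardinal.{u}) := mk_Iio_lt i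
      rw [Cardinal.lift_aleph, Ordinal.lift_one] at h2
      have h3 := h1.trans_lt h2
      exact Order.lt_succ_iff.1 (h3.trans_eq succ_aleph0.symm)
    refine (hcount.image f).mono ?_
    rintro _ ⟨⟨j, rfl⟩, hj⟩
    exact ⟨j, hf.lt_iff_lt.1 (lt_trans hj hi), rfl⟩
  · intro s hs hsδ
    have h : ∀ y : s, ∃ i, y.1 < f i := fun y => hlub y.1 (hsδ y.2)
    choose g hg using h
    have := hs.to_subtype
    obtain ⟨i, hi⟩ := exists_forall_lt_of_mk_lt isRegular_aleph_one g (by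
      rw [Cardinal.lift_aleph, Ordinal.lift_one]
      exact (Cardinal.mk_le_aleph0).trans_lt aleph0_lt_aleph_one)
    exact ⟨f i, hlt i, fun y hy => (hg ⟨y, hy⟩).trans (hf (hi ⟨y, hy⟩))⟩

/-- For `lam` strongly inaccessible, every subset `V` of every `δ` from a stationary set `S` is
coded by a set `B ⟨δ, V⟩`, and none of these sets is covered, below its `δ`, by countably many
others. The set `B ⟨δ, V⟩` consists of codes for the initial segments of `V`, along a cofinal
sequence in `δ` of length `ω₁`, so that two of these sets have bounded intersection. -/
theorem exists_separated_family (hreg : lam.IsRegular) (hunc : ℵ₀ < lam)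
    (hlim : ∀ μ < lam, 2 ^ μ < lam) :
    ∃ (S : Set (Iio lam.ord)) (B : (Σ δ : Iio lam.ord, Set (Iio (δ : Ordinal.{u}))) →
        Set (Iio lam.ord)),
      (∀ C : Set (Iio lam.ord), IsClub C → ∀ x, ∃ δ ∈ C, x < δ ∧ δ ∈ S) ∧
      (∀ δ ∈ S, ¬ Countable (Set (Iio (δ : Ordinal.{u})))) ∧
      ∀ δ ∈ S, ∀ (V : Set (Iio (δ : Ordinal.{u})))
        (A : Set (Σ δ : Iio lam.ord, Set (Iio (δ : Ordinal.{u})))), A.Countable →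
        (∀ j ∈ A, j.1 ∈ S) → ⟨δ, V⟩ ∉ A → ∃ γ < δ, γ ∈ B ⟨δ, V⟩ ∧ ∀ j ∈ A, γ ∉ B j := by
  classical
  have haleph : ℵ₁ < lam := (aleph_one_le_continuum).trans_lt (by
    rw [← two_power_aleph0]; exact hlim _ hunc)
  have hcode : Nonempty ((Σ δ : Iio lam.ord, Set (Iio (δ : Ordinal.{u}))) ↪ Iio lam.ord) := by
    rw [← Cardinal.le_def, mk_Iio_ord]
    exact mk_sigma_set_Iio_le hunc.le hlim
  obtain ⟨code⟩ := hcode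
  have hF1 : ∀ β : Iio lam.ord, ∃ z, ∀ U, code ⟨β, U⟩ < z := fun β =>
    exists_forall_lt_of_mk_lt hreg (fun U => code ⟨β, U⟩) (by
      rw [Cardinal.mk_set, Cardinal.mk_Iio_ordinal, ← Cardinal.lift_two_power, Cardinal.lift_lt]
      exact hlim _ (lt_ord.1 β.2))
  have hF2 : ∀ ξ : Iio lam.ord, ∃ z, ∀ j, code j ≤ ξ → j.1 < z := fun ξ => by
    obtain ⟨z, hz⟩ := exists_forall_lt_of_mk_lt hreg
      (fun p : {j // code j ≤ ξ} => p.1.1) (by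
        refine lt_of_le_of_lt ?_ (mk_subtype_le_lt hreg.aleph0_le ξ)
        exact Cardinal.mk_le_of_injective (f := fun p => ⟨code p.1, p.2⟩)
          fun p q h => Subtype.ext (code.injective (congrArg Subtype.val h)))
    exact ⟨z, fun j hj => hz ⟨j, hj⟩⟩
  choose F1 hF1 using hF1
  choose F2 hF2 using hF2
  -- if `δ` is closed under `F`, then for `β < δ` the codes of subsets of `β` are below `δ`, and an
  -- ordinal below `δ` codes a subset of an ordinal below `δ`
  let F : Iio lam.ord → Iio lam.ord := fun β => max (F1 β) (F2 β)
  let S : Set (Iio lam.ord) := {δ | (∀ β < δ, F β < δ) ∧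
    (∃ R : Set (Iio lam.ord), R ⊆ Iio δ ∧ (∀ β < δ, ∃ r ∈ R, β < r) ∧
        ∀ β < δ, (R ∩ Iio β).Countable) ∧ (∃ x, x < δ) ∧
      ∀ s : Set (Iio lam.ord), s.Countable → s ⊆ Iio δ → ∃ ξ < δ, ∀ y ∈ s, y < ξ}
  have hR : ∀ δ, ∃ R : Set (Iio lam.ord), δ ∈ S → R ⊆ Iio δ ∧ (∀ β < δ, ∃ r ∈ R, β < r) ∧
        ∀ β < δ, (R ∩ Iio β).Countable := fun δ => by
    by_cases h : δ ∈ S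
    · obtain ⟨R, hR⟩ := h.2.1
      exact ⟨R, fun _ => hR⟩
    · exact ⟨∅, fun h' => absurd h' h⟩
  choose R hR using hR
  -- `seg V β` is `V ∩ β`
  let seg : ∀ {δ : Iio lam.ord} (_ : Set (Iio (δ : Ordinal.{u}))) (β : Iio lam.ord),
      Set (Iio (β : Ordinal.{u})) := fun {δ} V β => {y | ∃ h : y.1 < δ, ⟨y.1, h⟩ ∈ V}
  let B : (Σ δ : Iio lam.ord, Set (Iio (δ : Ordinal.{u}))) → Set (Iio lam.ord) := fun j =>
    (fun β => code ⟨β, seg j.2 β⟩) '' R j.1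
  have hBlt : ∀ j, j.1 ∈ S → ∀ γ ∈ B j, γ < j.1 := by
    rintro j hj _ ⟨β, hβ, rfl⟩
    exact (hF1 β _).trans ((le_max_left _ _).trans_lt (hj.1 β ((hR _ hj).1 hβ)))
  have hBunb : ∀ j, j.1 ∈ S → ∀ ξ < j.1, ∃ γ ∈ B j, ξ < γ := by
    intro j hj ξ hξ
    obtain ⟨r, hr, hlt⟩ := (hR _ hj).2.1 _ (hj.1 ξ hξ)
    refine ⟨_, ⟨r, hr, rfl⟩, not_le.1 fun hle => ?_⟩
    exact lt_asymm hlt ((hF2 ξ _ hle).trans_le (le_max_right _ _))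
  have hpair : ∀ δ ∈ S, ∀ V, ∀ j, j.1 ∈ S → j ≠ ⟨δ, V⟩ →
      ∃ ξ < δ, ∀ γ ∈ B ⟨δ, V⟩, γ ∈ B j → γ < ξ := by
    intro δ hδ V j hj hne
    obtain ⟨δ', V'⟩ := j
    rcases lt_trichotomy δ' δ with hlt | rfl | hlt
    · exact ⟨δ', hlt, fun γ _ hγ => hBlt _ hj _ hγ⟩
    · have hVne : V' ≠ V := fun h => hne (by rw [h])
      obtain ⟨y, hy⟩ : ∃ y, ¬ (y ∈ V' ↔ y ∈ V) := by
        by_contra! h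
        exact hVne (Set.ext h)
      let y' : Iio lam.ord := ⟨y.1, lt_trans (Set.mem_Iio.1 y.2) (Set.mem_Iio.1 δ'.2)⟩
      have hy' : y' < δ' := y.2
      obtain ⟨r, hr, hyr⟩ := (hR _ hδ).2.1 y' hy'
      obtain ⟨ξ, hξ, hb⟩ := hδ.2.2.2 _
        ((((hR _ hδ).2.2 r ((hR _ hδ).1 hr))).image fun β => code ⟨β, seg V β⟩) (by
          rintro _ ⟨β, hβ, rfl⟩
          exact hBlt ⟨δ', V⟩ hδ _ ⟨β, hβ.1, rfl⟩)
      refine ⟨ξ, hξ, ?_⟩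
      rintro _ ⟨β, hβ, rfl⟩ ⟨β', hβ', he⟩
      refine hb _ ⟨β, ⟨hβ, ?_⟩, rfl⟩
      have he' := code.injective he
      rw [Sigma.mk.injEq] at he'
      obtain ⟨rfl, he'⟩ := he'
      have he' := eq_of_heq he'
      -- beyond `y` the initial segments of `V` and `V'` differ
      by_contra hle
      have hyβ : y' < β' := hyr.trans_le (not_lt.1 hle)
      have := Set.ext_iff.1 he' ⟨y.1, hyβ⟩
      refine hy ⟨fun h => ?_, fun h => ?_⟩
      · obtain ⟨_, h2⟩ := this.1 ⟨y.2, h⟩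
        exact h2
      · obtain ⟨_, h2⟩ := this.2 ⟨y.2, h⟩
        exact h2
    · obtain ⟨ξ, hξ, hb⟩ := hδ.2.2.2 (B ⟨δ', V'⟩ ∩ Iio δ) (by
        refine (((hR _ hj).2.2 δ hlt).image fun β => code ⟨β, seg V' β⟩).mono ?_
        rintro _ ⟨⟨β, hβ, rfl⟩, hlt'⟩
        refine ⟨β, ⟨hβ, ?_⟩, rfl⟩
        exact ((hF2 _ _ le_rfl).trans_le (le_max_right _ _)).trans (hδ.1 _ hlt'))
        Set.inter_subset_right
      exact ⟨ξ, hξ, fun γ h1 h2 => hb γ ⟨h2, hBlt _ hδ _ h1⟩⟩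
  refine ⟨S, B, fun C hC x => ?_, fun δ hδ hcount => ?_, fun δ hδ V A hA hAS hVA => ?_⟩
  · obtain ⟨δ, hδ, hx, hR', hs⟩ := exists_mem_club_cof_omega_one hreg haleph
      (hC.inter (cof_Iio_ord_ne_aleph0 hreg hunc) (isClub_setOf_forall_lt hreg hunc F)) x
    exact ⟨δ, hδ.1, hx, hδ.2, hR', ⟨x, hx⟩, hs⟩
  · -- a countable `δ` would be bounded in itself
    have hc : Countable (Iio (δ : Ordinal.{u})) :=
      Function.Injective.countable (f := fun y => ({y} : Set (Iio (δ : Ordinal.{u}))))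
        Set.singleton_injective
    have hc' : (Iio δ).Countable := by
      have hinj : Function.Injective fun y : Iio δ => (⟨y.1.1, y.2⟩ : Iio (δ : Ordinal.{u})) :=
        fun y z h => Subtype.ext (Subtype.ext (congrArg (fun t => t.1) h))
      exact Set.countable_coe_iff.1 hinj.countable
    obtain ⟨ξ, hξ, h⟩ := hδ.2.2.2 _ hc' subset_rfl
    exact lt_irrefl _ (h ξ hξ)
  · have h : ∀ j : A, ∃ ξ < δ, ∀ γ ∈ B ⟨δ, V⟩, γ ∈ B j.1 → γ < ξ := fun j =>
      hpair δ hδ V j.1 (hAS _ j.2) fun h => hVA (h ▸ j.2)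
    choose ξ hξ hb using h
    have := hA.to_subtype
    obtain ⟨η, hη, hηb⟩ := hδ.2.2.2 (Set.range ξ) (Set.countable_range _)
      (by rintro _ ⟨j, rfl⟩; exact hξ j)
    obtain ⟨γ, hγ, hlt⟩ := hBunb ⟨δ, V⟩ hδ η hη
    exact ⟨γ, hBlt _ hδ _ hγ, hγ, fun j hj hγj =>
      lt_asymm hlt ((hb ⟨j, hj⟩ γ hγ hγj).trans (hηb _ ⟨⟨j, hj⟩, rfl⟩))⟩

end SeparatedFamily

/-! ### Ultrafilters with prescribed patterns -/

section Patterns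

/-- The inclusion of `δ` into `lam`, for `δ < lam`. -/
def belowIncl {lam : Cardinal.{u}} (δ : Iio lam.ord) (γ : Iio (δ : Ordinal.{u})) : Iio lam.ord :=
  ⟨γ.1, lt_trans (Set.mem_Iio.1 γ.2) (Set.mem_Iio.1 δ.2)⟩

/-- The sets `Y b` (`b : B`) represent every relation between index sets of size at most `lam`. -/
def Represents {Ω B : Type u} (lam : Cardinal.{u}) (Y : B → Set Ω) : Prop :=
  ∀ (I J : Type u), #I ≤ lam → #J ≤ lam → ∀ R : I → J → Prop,
    ∃ (a : I → Ω) (b : J → B), ∀ i j, a i ∈ Y (b j) ↔ R i j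

/-- The set of the indices `γ < lam` for which `D γ` contains `Y b`. -/
def pattern {Ω B : Type u} {lam : Cardinal.{u}} (Y : B → Set Ω)
    (D : Iio lam.ord → Ultrafilter Ω) (b : B) : Set (Iio lam.ord) :=
  {γ | Y b ∈ D γ}

/-- An infinite set `I` has an independent family of `2 ^ #I` subsets (Hausdorff). -/
theorem exists_independent_family (I : Type u) [Infinite I] :
    ∃ A : Set I → Set I, ∀ (x : Set I → Prop) (W : Finset (Set I)),
      ∃ i, ∀ V ∈ W, i ∈ A V ↔ x V := by
  classical
  have hcard : #(Finset I × Finset (Finset I)) = #I := by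
    rw [Cardinal.mk_prod, Cardinal.lift_id, Cardinal.lift_id, Cardinal.mk_finset_of_infinite,
      Cardinal.mk_finset_of_infinite, Cardinal.mk_finset_of_infinite,
      Cardinal.mul_eq_self (Cardinal.aleph0_le_mk I)]
  obtain ⟨e⟩ := Cardinal.eq.1 hcard
  -- the index `(F, G)` belongs to the set `A V` if the trace of `V` on `F` is a member of `G`
  refine ⟨fun V => {i | (e.symm i).1.filter (· ∈ V) ∈ (e.symm i).2}, fun x W => ?_⟩
  -- a finite set on which distinct members of `W` have distinct traces
  have hsep : ∀ p : Set I × Set I, ∃ y, p.1 ≠ p.2 → ¬ (y ∈ p.1 ↔ y ∈ p.2) := by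
    intro p
    by_contra! h
    obtain ⟨y₀⟩ : Nonempty I := inferInstance
    exact (h y₀).1 (Set.ext fun y => (h y).2)
  choose s hs using hsep
  let F : Finset I := (W ×ˢ W).image s
  have hinj : ∀ V ∈ W, ∀ V' ∈ W, F.filter (· ∈ V) = F.filter (· ∈ V') → V = V' := by
    intro V hV V' hV' h
    by_contra hne
    have hy : s (V, V') ∈ F := Finset.mem_image_of_mem _ (Finset.mem_product.2 ⟨hV, hV'⟩)
    refine hs (V, V') hne ?_
    have := Finset.ext_iff.1 h (s (V, V'))
    simpa [hy] using this
  refine ⟨e (F, (W.filter x).image fun V => F.filter (· ∈ V)), fun V hV => ?_⟩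
  simp only [Set.mem_ofPred_eq, Equiv.symm_apply_apply, Finset.mem_image, Finset.mem_filter]
  constructor
  · rintro ⟨V', ⟨hV', hx⟩, h⟩
    rwa [← hinj V' hV' V hV h]
  · intro hx
    exact ⟨V, ⟨hV, hx⟩, rfl⟩

theorem exists_range_superset {α : Type u} {S : Type u} [Nonempty α] {X : Set α} (h : #X ≤ #S) :
    ∃ Q : S → α, X ⊆ Set.range Q := by
  classical
  obtain ⟨f⟩ := Cardinal.le_def _ _ |>.1 h
  refine ⟨fun s => if h : ∃ x, f x = s then h.choose.1 else Classical.arbitrary α, fun x hx => ?_⟩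
  refine ⟨f ⟨x, hx⟩, ?_⟩
  have h : ∃ y, f y = f ⟨x, hx⟩ := ⟨_, rfl⟩
  simp only [dif_pos h]
  rw [f.injective h.choose_spec]

variable {lam : Cardinal.{u}} {Ω B : Type u}

/-- The case that `lam ≤ 2 ^ μ` for some `μ < lam`. Points `a i` (`i` in a set of size `μ`) are
chosen of which the sets `Y b` contain every subset; the only further ultrafilter is the image of
an ultrafilter `d` on the index set. The set of patterns determines `d`, and there are more choices
of `d` than sets to be avoided. -/
theorem exists_ultrafilters_of_le_two_power (hunc : ℵ₀ < lam)
    {μ : Cardinal.{u}} (hμ : μ < lam) (hle : lam ≤ 2 ^ μ) (hge : ∀ ν < lam, 2 ^ ν ≤ lam)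
    {Y : B → Set Ω} (hY : Represents lam Y)
    (X : ∀ δ : Iio lam.ord, Set (Set (Set (Iio (δ : Ordinal.{u}))))) (δ₀ : Iio lam.ord)
    (hX : ∀ δ, δ₀ ≤ δ → #(X δ) ≤ #(Set (Iio (δ : Ordinal.{u})))) :
    ∃ D : Iio lam.ord → Ultrafilter Ω, #(Set.range (pattern Y D)) ≤ lift.{u + 1} lam ∧
      ∀ C : Set (Iio lam.ord), IsClub C →
        ∃ δ ∈ C, (Set.range fun b => belowIncl δ ⁻¹' pattern Y D b) ∉ X δ := by
  classical
  let I : Type u := μ.out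
  have hI : #I = μ := Cardinal.mk_out μ
  have hinf : ℵ₀ ≤ μ := by
    by_contra! h
    exact (hunc.trans_le hle).not_gt (Cardinal.power_lt_aleph0 (natCast_lt_aleph0 (n := 2)) h)
  have : Infinite I := Cardinal.infinite_iff.2 (hI ▸ hinf)
  have hSet : #(Set I) = lam := by
    rw [Cardinal.mk_set, hI]; exact le_antisymm (hge μ hμ) hle
  obtain ⟨a, b, hab⟩ := hY I (Set I) (hI ▸ hμ.le) hSet.le fun i V => i ∈ V
  -- every index `i : Option I` is taken at some `γ < μ`
  have hord : μ.ord < lam.ord := ord_lt_ord.2 hμ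
  obtain ⟨e⟩ : Nonempty (Iio μ.ord ≃ Option I) := by
    have := Cardinal.lift_mk_eq'.{u + 1, u} (α := Iio μ.ord) (β := Option I)
    refine this.1 ?_
    rw [mk_Iio_ord, Cardinal.mk_option, hI, Cardinal.add_one_eq hinf]
    simp
  let g : Iio lam.ord → Option I := fun γ => if h : γ.1 < μ.ord then e ⟨γ.1, h⟩ else none
  have hg : ∀ δ : Iio lam.ord, μ.ord ≤ δ.1 → ∀ o, ∃ γ, g (belowIncl δ γ) = o := by
    intro δ hδ o
    refine ⟨⟨(e.symm o).1, lt_of_lt_of_le (Set.mem_Iio.1 (e.symm o).2) hδ⟩, ?_⟩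
    have h : ((e.symm o).1 : Ordinal.{u}) < μ.ord := (e.symm o).2
    simp only [g, belowIncl, dif_pos h]
    exact e.apply_symm_apply o
  let δ₁ : Iio lam.ord := max δ₀ ⟨μ.ord, hord⟩
  obtain ⟨A, hA⟩ := exists_independent_family I
  let XX : Set (Σ δ : Iio lam.ord, Set (Set (Iio (δ : Ordinal.{u})))) :=
    {p | δ₁ ≤ p.1 ∧ p.2 ∈ X p.1}
  have hXX : #XX ≤ #(ULift.{u + 1} (Set I)) := by
    rw [Cardinal.mk_uLift, hSet]
    have h1 : #XX ≤ #(Σ δ : {δ : Iio lam.ord // δ₁ ≤ δ}, X δ.1) :=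
      Cardinal.mk_le_of_injective (f := fun p => ⟨⟨p.1.1, p.2.1⟩, ⟨p.1.2, p.2.2⟩⟩) (by
        rintro ⟨⟨δ, Q⟩, h1, h2⟩ ⟨⟨δ', Q'⟩, h1', h2'⟩ h
        simp only [Sigma.mk.injEq, Subtype.mk.injEq] at h
        obtain ⟨rfl, h⟩ := h
        simpa using h)
    refine h1.trans ?_
    rw [Cardinal.mk_sigma]
    refine (Cardinal.sum_le_sum _ (fun _ => lift.{u + 1} lam) fun δ => ?_).trans ?_
    · refine (hX δ.1 ((le_max_left _ _).trans δ.2)).trans ?_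
      rw [Cardinal.mk_set, Cardinal.mk_Iio_ordinal, ← Cardinal.lift_two_power, Cardinal.lift_le]
      exact hge _ (lt_ord.1 δ.1.2)
    · rw [Cardinal.sum_const']
      refine Cardinal.mul_le_of_le (by simpa using hunc.le) ?_ le_rfl
      rw [← mk_Iio_ord]
      exact Cardinal.mk_subtype_le _
  have : Nonempty (Σ δ : Iio lam.ord, Set (Set (Iio (δ : Ordinal.{u})))) := ⟨⟨δ₀, ∅⟩⟩
  obtain ⟨q, hq⟩ := exists_range_superset hXX
  -- `tr δ V` is the pattern below `δ` of a set `Y b` that contains `a i` exactly for `i ∈ V`, if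
  -- `V ∉ d`
  let tr : ∀ δ : Iio lam.ord, Set I → Set (Iio (δ : Ordinal.{u})) := fun δ V =>
    {γ | ∃ i ∈ V, g (belowIncl δ γ) = some i}
  -- the ultrafilter `d` is chosen to differ from the one that the `V`-th set to be avoided codes
  obtain ⟨d, hd⟩ := exists_ultrafilter_mem_iff A hA fun V => tr (q ⟨V⟩).1 (A V) ∈ (q ⟨V⟩).2
  let D : Iio lam.ord → Ultrafilter Ω := fun γ =>
    match g γ with
    | some i => pure (a i)
    | none => d.map a
  have hDsome : ∀ γ i, g γ = some i → ∀ Z, Z ∈ D γ ↔ a i ∈ Z := by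
    intro γ i h Z
    simp only [D, h]
    exact Ultrafilter.mem_pure
  have hDnone : ∀ γ, g γ = none → ∀ Z, Z ∈ D γ ↔ a ⁻¹' Z ∈ d := by
    intro γ h Z
    simp only [D, h]
    exact Ultrafilter.mem_map
  refine ⟨D, ?_, fun C hC => ?_⟩
  · let Ψ : Set I → Set (Iio lam.ord) := fun V =>
      {γ | (∃ i ∈ V, g γ = some i) ∨ (g γ = none ∧ V ∈ d)}
    have hsub : Set.range (pattern Y D) ⊆ Set.range Ψ := by
      rintro _ ⟨y, rfl⟩
      refine ⟨a ⁻¹' Y y, ?_⟩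
      ext γ
      rcases h : g γ with _ | i
      · simp [Ψ, pattern, h, hDnone γ h]
      · simp [Ψ, pattern, h, hDsome γ i h]
    refine (Cardinal.mk_le_mk_of_subset hsub).trans ?_
    have := Cardinal.mk_range_le_lift (f := Ψ)
    rw [hSet] at this
    rwa [Cardinal.lift_id'.{u, u + 1}] at this
  · obtain ⟨δ, hδC, hδ⟩ := hC.isCofinal δ₁
    refine ⟨δ, hδC, fun hmem => ?_⟩
    obtain ⟨⟨V⟩, hV⟩ : ∃ V, q V = ⟨δ, Set.range fun b => belowIncl δ ⁻¹' pattern Y D b⟩ :=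
      hq ⟨hδ, hmem⟩
    have hdV := hd V
    rw [hV] at hdV
    have hgδ := hg δ (show (⟨μ.ord, hord⟩ : Iio lam.ord) ≤ δ from (le_max_right _ _).trans hδ)
    have key : tr δ (A V) ∈ (Set.range fun b => belowIncl δ ⁻¹' pattern Y D b) ↔ A V ∉ d := by
      constructor
      · rintro ⟨y, hy⟩ hAd
        have hpre : a ⁻¹' Y y = A V := by
          ext i
          obtain ⟨γ, hγ⟩ := hgδ (some i)
          have := Set.ext_iff.1 hy γ
          simpa [tr, pattern, hγ, hDsome _ _ hγ] using this
        obtain ⟨γ, hγ⟩ := hgδ none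
        have := Set.ext_iff.1 hy γ
        simp [tr, pattern, hγ, hDnone _ hγ, hpre, hAd] at this
      · intro hAd
        refine ⟨b (A V), ?_⟩
        have hpre : a ⁻¹' Y (b (A V)) = A V := Set.ext fun i => hab i (A V)
        ext γ
        rcases h : g (belowIncl δ γ) with _ | i
        · simp [tr, pattern, h, hDnone _ h, hpre, hAd]
        · simp [tr, pattern, h, hDsome _ _ h, hab]
    rw [key] at hdV
    by_cases h : A V ∈ d
    · exact hdV.1 h h
    · exact h (hdV.2 h)

/-- The case that `lam` is a strong limit. Ultrafilters `D γ` are chosen along the points of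
`J → Bool` coded by a family of separated sets `B ⟨δ, V⟩`; the pattern of each `Y b` depends on
countably many of these sets, so that `B ⟨δ, V⟩` is a pattern below `δ` only if it was put into the
family, which is decided against `X δ`. -/
theorem exists_ultrafilters_of_strongLimit (hreg : lam.IsRegular) (hunc : ℵ₀ < lam)
    (hlim : ∀ μ < lam, 2 ^ μ < lam) (hpow : lam ^ (ℵ₀ : Cardinal.{u}) ≤ lam)
    {Y : B → Set Ω} (hY : Represents lam Y)
    (X : ∀ δ : Iio lam.ord, Set (Set (Set (Iio (δ : Ordinal.{u}))))) (δ₀ : Iio lam.ord)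
    (hX : ∀ δ, δ₀ ≤ δ → #(X δ) ≤ #(Set (Iio (δ : Ordinal.{u})))) :
    ∃ D : Iio lam.ord → Ultrafilter Ω, #(Set.range (pattern Y D)) ≤ lift.{u + 1} lam ∧
      ∀ C : Set (Iio lam.ord), IsClub C →
        ∃ δ ∈ C, (Set.range fun b => belowIncl δ ⁻¹' pattern Y D b) ∉ X δ := by
  classical
  obtain ⟨S, E, hS, hSunc, hsep⟩ := exists_separated_family hreg hunc hlim
  have hQ : ∀ δ : Iio lam.ord, ∃ Q : Set (Iio (δ : Ordinal.{u})) →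
      Set (Set (Iio (δ : Ordinal.{u}))), δ₀ ≤ δ → X δ ⊆ Set.range Q := fun δ => by
    by_cases h : δ₀ ≤ δ
    · obtain ⟨Q, hQ⟩ := exists_range_superset (hX δ h)
      exact ⟨Q, fun _ => hQ⟩
    · exact ⟨fun _ => ∅, fun h' => absurd h' h⟩
  choose Q hQ using hQ
  -- `good ⟨δ, V⟩` makes `E ⟨δ, V⟩ ∩ δ` a pattern below `δ` iff it is not a member of the set that
  -- `V` enumerates, so that the set of patterns below `δ` differs from all of them
  let K := Σ δ : Iio lam.ord, Set (Iio (δ : Ordinal.{u}))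
  let J : Type u := lam.out
  have hJ : #J = lam := Cardinal.mk_out lam
  have hJinf : Infinite J := Cardinal.infinite_iff.2 (hJ ▸ hunc.le)
  obtain ⟨c⟩ : Nonempty (K ↪ J) := by
    rw [← Cardinal.lift_mk_le', hJ, Cardinal.lift_id'.{u, u + 1}]
    exact mk_sigma_set_Iio_le hunc.le hlim
  let good : K → Prop := fun j => j.1 ∈ S ∧ belowIncl j.1 ⁻¹' E j ∉ Q j.1 j.2
  obtain ⟨a, b, hab⟩ := hY (Finset J) J (by rw [Cardinal.mk_finset_of_infinite, hJ]) hJ.le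
    fun s j => j ∈ s
  obtain ⟨D, hD, hDs⟩ := exists_ultrafilter_countable_support (fun j => Y (b j)) (by
    intro x W
    refine ⟨a (W.filter x), fun j hj => ?_⟩
    rw [hab]; simp [hj])
  let x : Iio lam.ord → J → Bool := fun γ j => decide (∃ i, c i = j ∧ good i ∧ γ ∈ E i)
  have hx : ∀ γ i, x γ (c i) = true ↔ good i ∧ γ ∈ E i := by
    intro γ i
    simp only [x, decide_eq_true_eq]
    constructor
    · rintro ⟨i', h, h'⟩
      rwa [c.injective h] at h'
    · intro h
      exact ⟨i, rfl, h⟩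
  refine ⟨fun γ => D (x γ), ?_, fun C hC => ?_⟩
  · let Ψ : (ℕ → J) × Set (ℕ → Bool) → Set (Iio lam.ord) := fun p => {γ | x γ ∘ p.1 ∈ p.2}
    have hsub : Set.range (pattern Y fun γ => D (x γ)) ⊆ Set.range Ψ := by
      rintro _ ⟨y, rfl⟩
      obtain ⟨w, hw, hdep⟩ := hDs (Y y)
      obtain ⟨j₀⟩ : Nonempty J := inferInstance
      obtain ⟨f, hf⟩ := (hw.insert j₀).exists_eq_range (Set.insert_nonempty _ _)
      refine ⟨(f, {z | ∃ γ, x γ ∘ f = z ∧ Y y ∈ D (x γ)}), ?_⟩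
      ext γ
      constructor
      · rintro ⟨γ', h, h'⟩
        refine (hdep _ _ fun j hj => ?_).1 h'
        obtain ⟨n, rfl⟩ : j ∈ Set.range f := hf ▸ Set.mem_insert_of_mem _ hj
        exact congrFun h n
      · intro h
        exact ⟨γ, rfl, h⟩
    refine (Cardinal.mk_le_mk_of_subset hsub).trans ?_
    have h1 := Cardinal.mk_range_le_lift (f := Ψ)
    rw [Cardinal.lift_id'.{u, u + 1}] at h1
    refine h1.trans (Cardinal.lift_le.2 ?_)
    have h2 : (2 : Cardinal.{u}) ^ ((2 : Cardinal.{u}) ^ (ℵ₀ : Cardinal.{u})) < lam :=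
      hlim _ (hlim _ hunc)
    have h3 : #((ℕ → J) × Set (ℕ → Bool)) =
        lam ^ (ℵ₀ : Cardinal.{u}) * 2 ^ ((2 : Cardinal.{u}) ^ (ℵ₀ : Cardinal.{u})) := by
      rw [Cardinal.mk_prod]
      simp [hJ]
    rw [h3]
    exact Cardinal.mul_le_of_le hunc.le hpow h2.le
  · obtain ⟨δ, hδC, hδ₀, hδS⟩ := hS C hC δ₀
    refine ⟨δ, hδC, fun hmem => ?_⟩
    obtain ⟨V, hV⟩ := hQ δ hδ₀.le hmem
    have key : belowIncl δ ⁻¹' E ⟨δ, V⟩ ∈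
        (Set.range fun b => belowIncl δ ⁻¹' pattern Y (fun γ => D (x γ)) b) ↔ good ⟨δ, V⟩ := by
      constructor
      · rintro ⟨y, hy⟩
        by_contra hgood
        obtain ⟨w, hw, hdep⟩ := hDs (Y y)
        let A : Set K := {i | c i ∈ w ∧ good i}
        have hA : A.Countable := by
          refine Set.Countable.mono (fun i hi => hi.1) (hw.preimage_of_injOn (f := c) ?_)
          exact c.injective.injOn
        have hAS : ∀ i ∈ A, i.1 ∈ S := fun i hi => hi.2.1
        have hzero : ∀ γ, (∀ i ∈ A, γ ∉ E i) → ∀ j ∈ w, x γ j = false := by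
          intro γ hγ j hj
          by_contra hne
          rw [Bool.not_eq_false] at hne
          obtain ⟨i, rfl, hi⟩ := of_decide_eq_true hne
          exact hγ i ⟨hj, hi.1⟩ hi.2
        have hmemiff : ∀ γ, γ < δ → (γ ∈ E ⟨δ, V⟩ ↔ Y y ∈ D (x γ)) := fun γ hγ =>
          (Set.ext_iff.1 hy ⟨γ.1, hγ⟩).symm
        obtain ⟨γ₁, hγ₁, hγ₁E, hγ₁A⟩ := hsep δ hδS V A hA hAS fun h => hgood h.2
        -- a further set, outside the countable support and different from `V`
        obtain ⟨V', hV'⟩ : ∃ V', (⟨δ, V'⟩ : K) ∉ insert (⟨δ, V⟩ : K) A := by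
          by_contra! h
          refine hSunc δ hδS ?_
          have hc : (insert (⟨δ, V⟩ : K) A).Countable := hA.insert _
          have := hc.to_subtype
          refine Function.Injective.countable
            (f := fun V' => (⟨⟨δ, V'⟩, h V'⟩ : ↥(insert (⟨δ, V⟩ : K) A))) fun V₁ V₂ h => ?_
          exact eq_of_heq (Sigma.mk.inj (congrArg Subtype.val h)).2
        obtain ⟨γ₂, hγ₂, -, hγ₂A⟩ := hsep δ hδS V' (insert ⟨δ, V⟩ A) (hA.insert _)
          (by rintro i (rfl | hi); exacts [hδS, hAS i hi]) hV'
        have h1 := hzero γ₁ hγ₁A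
        have h2 := hzero γ₂ fun i hi => hγ₂A i (Set.mem_insert_of_mem _ hi)
        refine hγ₂A _ (Set.mem_insert _ _) ((hmemiff γ₂ hγ₂).2 ?_)
        exact (hdep _ _ fun j hj => by rw [h1 j hj, h2 j hj]).1 ((hmemiff γ₁ hγ₁).1 hγ₁E)
      · intro hgood
        refine ⟨b (c ⟨δ, V⟩), ?_⟩
        ext γ
        change Y (b (c ⟨δ, V⟩)) ∈ D (x (belowIncl δ γ)) ↔ belowIncl δ γ ∈ E ⟨δ, V⟩
        rw [hD, hx]
        exact ⟨fun h => h.2, fun h => ⟨hgood, h⟩⟩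
    rw [← hV] at key
    by_cases h : belowIncl δ ⁻¹' E ⟨δ, V⟩ ∈ Q δ V
    · exact (key.1 h).2 h
    · exact h (key.2 ⟨hδS, h⟩)

/-- If at most `2 ^ #δ` sets of subsets of `δ` are to be avoided at each `δ < lam`, then there are
ultrafilters `D γ` (`γ < lam`) with at most `lam` patterns in total such that the set of patterns
below `δ` is not among those to be avoided, for stationarily many `δ`. -/
theorem exists_ultrafilters (hreg : lam.IsRegular) (hunc : ℵ₀ < lam) (hpow : lam ^< lam = lam)
    {Y : B → Set Ω} (hY : Represents lam Y)
    (X : ∀ δ : Iio lam.ord, Set (Set (Set (Iio (δ : Ordinal.{u}))))) (δ₀ : Iio lam.ord)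
    (hX : ∀ δ, δ₀ ≤ δ → #(X δ) ≤ #(Set (Iio (δ : Ordinal.{u})))) :
    ∃ D : Iio lam.ord → Ultrafilter Ω, #(Set.range (pattern Y D)) ≤ lift.{u + 1} lam ∧
      ∀ C : Set (Iio lam.ord), IsClub C →
        ∃ δ ∈ C, (Set.range fun b => belowIncl δ ⁻¹' pattern Y D b) ∉ X δ := by
  have hp : ∀ ν < lam, lam ^ ν ≤ lam := fun ν hν => (le_powerlt lam hν).trans_eq hpow
  by_cases h : ∀ μ < lam, 2 ^ μ < lam
  · exact exists_ultrafilters_of_strongLimit hreg hunc h (hp _ hunc) hY X δ₀ hX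
  · push Not at h
    obtain ⟨μ, hμ, hle⟩ := h
    refine exists_ultrafilters_of_le_two_power hunc hμ hle (fun ν hν => ?_) hY X δ₀ hX
    exact (Cardinal.power_le_power_right
      ((natCast_lt_aleph0 (n := 2)).le.trans hunc.le)).trans (hp ν hν)

end Patterns

/-! ### The invariants along a saturated chain -/

section Invariants

variable {L : FirstOrder.Language.{u, u}}

open FirstOrder.Language

section Invariant

variable {N : Type u} [L.Structure N] {lam kappa : Cardinal.{u}} {m k : ℕ}

/-- A family in the local invariant is determined by the tuples `a i γ` with entries below `δ`. -/
theorem mk_localInv_le (φ : L.Formula (Fin m ⊕ Fin k)) (hkappa : ℵ₀ ≤ kappa)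
    (e : N ≃ Iio lam.ord) (δ : Iio lam.ord) (hδ : kappa.ord ≤ δ.1) :
    #(localInv φ kappa e δ) ≤ #(Set (Iio (δ : Ordinal.{u}))) := by
  classical
  let A := Iio kappa.ord → Iio (δ : Ordinal.{u}) → Fin m → Iio (δ : Ordinal.{u})
  let Ψ : A → Set (Set (Iio (δ : Ordinal.{u}))) := fun a =>
    {U | ∃ b : Fin k → N, ∃ i₀ : Iio kappa.ord, ∀ i, i₀ ≤ i → ∀ γ,
      φ.Realize (Sum.elim (fun j => e.symm (belowIncl δ (a i γ j))) b) ↔ γ ∈ U}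
  have hsub : localInv φ kappa e δ ⊆ Set.range Ψ := by
    rintro P ⟨a, ha, hP⟩
    refine ⟨fun i γ j => ⟨(e (a i γ j)).1, ha i γ j⟩, ?_⟩
    ext U
    rw [hP]
    have : ∀ i γ, (fun j => e.symm (belowIncl δ ⟨(e (a i γ j)).1, ha i γ j⟩)) = a i γ :=
      fun i γ => funext fun j => e.symm_apply_apply _
    simp only [Ψ, Set.mem_ofPred_eq, this]
  refine (Cardinal.mk_le_mk_of_subset hsub).trans (Cardinal.mk_range_le.trans ?_)
  have hκ : #(Iio kappa.ord) ≤ #(Iio (δ : Ordinal.{u})) :=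
    Cardinal.mk_le_of_injective (f := fun γ => ⟨γ.1, lt_of_lt_of_le (Set.mem_Iio.1 γ.2) hδ⟩)
      fun x y h => Subtype.ext (congrArg (fun z => z.1) h)
  have hinf : ℵ₀ ≤ #(Iio (δ : Ordinal.{u})) := by
    refine le_trans ?_ hκ
    rw [mk_Iio_ord]; simpa using hkappa
  have hA : #A = ((#(Iio (δ : Ordinal.{u})) ^ (m : Cardinal.{u + 1})) ^ #(Iio (δ : Ordinal.{u}))) ^
      #(Iio kappa.ord) := by
    simp [A]
  rw [hA, Cardinal.mk_set]
  set d := #(Iio (δ : Ordinal.{u}))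
  calc ((d ^ (m : Cardinal.{u + 1})) ^ d) ^ #(Iio kappa.ord)
      ≤ ((2 ^ d) ^ d) ^ #(Iio kappa.ord) := by
        refine Cardinal.power_le_power_right (Cardinal.power_le_power_right ?_)
        exact (Cardinal.power_nat_le hinf).trans (Cardinal.cantor d).le
    _ ≤ ((2 ^ d) ^ d) ^ d := Cardinal.power_le_power_left
        (Cardinal.power_ne_zero _ (Cardinal.power_ne_zero _ two_ne_zero)) hκ
    _ = 2 ^ d := by
        rw [← Cardinal.power_mul, ← Cardinal.power_mul, Cardinal.mul_eq_self hinf,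
          Cardinal.mul_eq_self hinf]

theorem localInv_eq_of_forall_lt_iff (φ : L.Formula (Fin m ⊕ Fin k)) (e e' : N ≃ Iio lam.ord)
    (δ : Iio lam.ord) (h : ∀ x, e x < δ ↔ e' x < δ) :
    localInv φ kappa e δ = localInv φ kappa e' δ := by
  simp only [localInv, h]

/-- The local invariant does not depend on the enumeration of the model, up to a club. -/
theorem exists_club_localInv_eq (hreg : lam.IsRegular) (hunc : ℵ₀ < lam)
    (φ : L.Formula (Fin m ⊕ Fin k)) (e e' : N ≃ Iio lam.ord) :
    ∃ C : Set (Iio lam.ord), IsClub C ∧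
      ∀ δ ∈ C, localInv φ kappa e δ = localInv φ kappa e' δ := by
  refine ⟨_, isClub_setOf_forall_lt hreg hunc fun β => max (e (e'.symm β)) (e' (e.symm β)),
    fun δ hδ => localInv_eq_of_forall_lt_iff φ e e' δ fun x => ⟨fun h => ?_, fun h => ?_⟩⟩
  · simpa using (le_max_right _ _).trans_lt (hδ _ h)
  · simpa using (le_max_left _ _).trans_lt (hδ _ h)

theorem localInv_equiv {N' : Type u} [L.Structure N'] (φ : L.Formula (Fin m ⊕ Fin k))
    (f : N ≃[L] N') (e : N' ≃ Iio lam.ord) :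
    localInv φ kappa (f.toEquiv.trans e) = localInv φ kappa e := by
  have hreal : ∀ (a : Fin m → N) (b : Fin k → N),
      φ.Realize (Sum.elim a b) ↔ φ.Realize (Sum.elim (f ∘ a) (f ∘ b)) := by
    intro a b
    rw [← StrongHomClass.realize_formula f, Sum.comp_elim]
  have hsymm : ∀ {n : ℕ} (a : Fin n → N'), f ∘ (f.symm ∘ a) = a := fun a =>
    funext fun j => f.apply_symm_apply _
  funext δ
  ext P
  constructor
  · rintro ⟨a, ha, hP⟩
    refine ⟨fun i γ => f ∘ a i γ, ha, fun U => (hP U).trans ⟨?_, ?_⟩⟩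
    · rintro ⟨b, i₀, hb⟩
      exact ⟨f ∘ b, i₀, fun i hi γ => (hreal _ _).symm.trans (hb i hi γ)⟩
    · rintro ⟨b, i₀, hb⟩
      refine ⟨f.symm ∘ b, i₀, fun i hi γ => ?_⟩
      rw [hreal, hsymm]
      exact hb i hi γ
  · rintro ⟨a, ha, hP⟩
    refine ⟨fun i γ => f.symm ∘ a i γ, fun i γ j => ?_, fun U => (hP U).trans ⟨?_, ?_⟩⟩
    · have : (f.toEquiv.trans e) ((f.symm ∘ a i γ) j) = e (a i γ j) :=
        congrArg e (f.apply_symm_apply _)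
      rw [this]; exact ha i γ j
    · rintro ⟨b, i₀, hb⟩
      refine ⟨f.symm ∘ b, i₀, fun i hi γ => ?_⟩
      rw [hreal, hsymm, hsymm]
      exact hb i hi γ
    · rintro ⟨b, i₀, hb⟩
      refine ⟨f ∘ b, i₀, fun i hi γ => ?_⟩
      rw [← hsymm (a i γ), ← hreal]
      exact hb i hi γ

theorem exists_club_of_clubInv_eq (hreg : lam.IsRegular) (hunc : ℵ₀ < lam)
    {N' : Type u} [L.Structure N'] {φ : L.Formula (Fin m ⊕ Fin k)} {e : N ≃ Iio lam.ord}
    {e' : N' ≃ Iio lam.ord} (h : clubInv φ kappa e = clubInv φ kappa e') :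
    ∃ C : Set (Iio lam.ord), IsClub C ∧
      ∀ δ ∈ C, localInv φ kappa e δ = localInv φ kappa e' δ :=
  (mem_clubFilter_iff hreg hunc).1 (Quotient.exact h)

end Invariant

/-- The subsets of `M ^ m` that are defined by `φ` with parameters `b`. -/
def definedSet {M : Type u} [L.Structure M] {m k : ℕ} (φ : L.Formula (Fin m ⊕ Fin k))
    (b : Fin k → M) : Set (Fin m → M) :=
  {c | φ.Realize (Sum.elim c b)}

section Chain

variable {T : L.Theory} {lam kappa : Cardinal.{u}} {M : Type u} [L.Structure M] [Nonempty M]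
  {Ms : Iio (Order.succ lam).ord → L.ElementarySubstructure M}

theorem IsSaturatedChain.nonempty_equiv (h : IsSaturatedChain T lam M Ms)
    (α : Iio (Order.succ lam).ord) : Nonempty (Ms α ≃ Iio lam.ord) := by
  have := Cardinal.lift_mk_eq'.{u, u + 1} (α := Ms α) (β := Iio lam.ord)
  refine this.1 ?_
  rw [h.card_stage, mk_Iio_ord, Cardinal.lift_lift]

theorem exists_forall_mem_stage (hinf : ℵ₀ ≤ lam) (h : IsSaturatedChain T lam M Ms) {n : ℕ}
    (a : Fin n → M) : ∃ z, ∀ j, a j ∈ Ms z := by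
  have hst : ∀ x : M, ∃ z, x ∈ Ms z := fun x => by
    have : x ∈ ⋃ α, (Ms α : Set M) := h.iUnion_eq ▸ Set.mem_univ x
    simpa using this
  choose st hst using hst
  obtain ⟨z, hz⟩ := exists_forall_lt_of_card_lt (isRegular_succ hinf) (fun j => st (a j)) (by
    rw [Cardinal.mk_fin, Cardinal.lift_natCast, Cardinal.lift_uzero]
    exact (natCast_lt_aleph0.trans_le hinf).trans (Order.lt_succ lam))
  exact ⟨z, fun j => h.mono (hz j).le (hst _)⟩

/-- Everything of size at most `lam` that is needed for ultrafilters `D γ` happens at some stage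
`z`: their averages over the stage `β` are realized, and all patterns occur. -/
theorem exists_stage (hinf : ℵ₀ ≤ lam) (h : IsSaturatedChain T lam M Ms) {m k : ℕ}
    (φ : L.Formula (Fin m ⊕ Fin k)) (D : Iio lam.ord → Ultrafilter (Fin m → M))
    (hD : #(Set.range (pattern (definedSet φ) D)) ≤ lift.{u + 1} lam)
    (β : Iio (Order.succ lam).ord) :
    ∃ z, (∀ γ, ∃ a : Fin m → M, (∀ j, a j ∈ Ms z) ∧ ∀ b : Fin k → M, (∀ j, b j ∈ Ms β) →
        (φ.Realize (Sum.elim a b) ↔ γ ∈ pattern (definedSet φ) D b)) ∧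
      ∀ b : Fin k → M, ∃ b' : Fin k → M, (∀ j, b' j ∈ Ms z) ∧
        pattern (definedSet φ) D b' = pattern (definedSet φ) D b := by
  have hMinf : ℵ₀ ≤ #M := h.card_eq ▸ hinf.trans (Order.le_succ lam)
  have hlt : lift.{u + 1} lam < lift.{u + 1} (Order.succ lam) :=
    Cardinal.lift_lt.2 (Order.lt_succ lam)
  have hav : ∀ γ, ∃ a : Fin m → M, ∀ b : Fin k → M, (∀ j, b j ∈ Ms β) →
      (φ.Realize (Sum.elim a b) ↔ γ ∈ pattern (definedSet φ) D b) := fun γ =>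
    h.saturated.exists_average hMinf φ (Ms β : Set M) (by
      rw [h.card_eq]; exact (h.card_stage β).trans_lt (Order.lt_succ lam)) (D γ)
  choose a ha using hav
  have h1 : ∀ γ, ∃ z, ∀ j, a γ j ∈ Ms z := fun γ => exists_forall_mem_stage hinf h (a γ)
  choose z1 hz1 using h1
  have h2 : ∀ U : Set.range (pattern (definedSet φ) D), ∃ z, ∃ b : Fin k → M,
      (∀ j, b j ∈ Ms z) ∧ pattern (definedSet φ) D b = U.1 := by
    rintro ⟨_, b, rfl⟩
    obtain ⟨z, hz⟩ := exists_forall_mem_stage hinf h b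
    exact ⟨z, b, hz, rfl⟩
  choose z2 hz2 using h2
  obtain ⟨y1, hy1⟩ := exists_forall_lt_of_mk_lt (isRegular_succ hinf) z1
    ((mk_Iio_ord lam).trans_lt hlt)
  obtain ⟨y2, hy2⟩ := exists_forall_lt_of_mk_lt (isRegular_succ hinf) z2 (hD.trans_lt hlt)
  refine ⟨max y1 y2, fun γ => ⟨a γ, fun j => ?_, ha γ⟩, fun b => ?_⟩
  · exact h.mono ((hy1 γ).le.trans (le_max_left _ _)) (hz1 γ j)
  · obtain ⟨b', hb', hpat⟩ := hz2 ⟨_, b, rfl⟩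
    exact ⟨b', fun j => h.mono ((hy2 _).le.trans (le_max_right _ _)) (hb' j), hpat⟩

/-- At a limit stage of cofinality `kappa` that is closed under `exists_stage`, the patterns below
`δ` form a member of the local invariant at `δ`, for a club of `δ < lam`. The tuples `a i γ`
realize the average of `D γ` over larger and larger stages. -/
theorem exists_club_range_mem_localInv (hreg : lam.IsRegular) (hunc : ℵ₀ < lam)
    (hkappa_reg : kappa.IsRegular) (hkappa_lt : kappa < lam)
    (h : IsSaturatedChain T lam M Ms) {m k : ℕ}
    (φ : L.Formula (Fin m ⊕ Fin k)) (D : Iio lam.ord → Ultrafilter (Fin m → M))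
    (α ε : Iio (Order.succ lam).ord) (hα : α < ε) (hε : (ε : Ordinal).cof = kappa)
    (g : Iio (Order.succ lam).ord → Iio (Order.succ lam).ord) (hgε : ∀ β < ε, g β < ε)
    (hg : ∀ β, α ≤ β →
      (∀ γ, ∃ a : Fin m → M, (∀ j, a j ∈ Ms (g β)) ∧ ∀ b : Fin k → M, (∀ j, b j ∈ Ms β) →
        (φ.Realize (Sum.elim a b) ↔ γ ∈ pattern (definedSet φ) D b)) ∧
      ∀ b : Fin k → M, ∃ b' : Fin k → M, (∀ j, b' j ∈ Ms (g β)) ∧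
        pattern (definedSet φ) D b' = pattern (definedSet φ) D b)
    (e : Ms ε ≃ Iio lam.ord) :
    ∃ C : Set (Iio lam.ord), IsClub C ∧ ∀ δ ∈ C,
      (Set.range fun b => belowIncl δ ⁻¹' pattern (definedSet φ) D b) ∈
        localInv φ kappa e δ := by
  have hreal : ∀ (a : Fin m → Ms ε) (b : Fin k → Ms ε), φ.Realize (Sum.elim a b) ↔
      φ.Realize (Sum.elim (fun j => (a j : M)) fun j => (b j : M)) := by
    intro a b
    rw [← (Ms ε).subtype.map_formula φ, Sum.comp_elim]
    rfl
  have hlim : Order.IsSuccLimit (ε : Ordinal) := by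
    rw [← Ordinal.one_lt_cof_iff, ← Ordinal.aleph0_le_cof_iff, hε]
    exact hkappa_reg.aleph0_le
  obtain ⟨f, hf⟩ := exists_eventually_ge_of_cof hε
  let s : Iio kappa.ord → Iio (Order.succ lam).ord := fun i => max α (belowIncl ε (f i))
  have hs : ∀ i, s i < ε := fun i => max_lt hα (f i).2
  have hsge : ∀ β < ε, ∃ i₀, ∀ i, i₀ ≤ i → β ≤ s i := fun β hβ => by
    obtain ⟨i₀, hi₀⟩ := hf ⟨β.1, hβ⟩
    exact ⟨i₀, fun i hi => le_max_of_le_right (hi₀ i hi)⟩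
  have hav : ∀ (i : Iio kappa.ord) (γ : Iio lam.ord), ∃ a : Fin m → Ms ε, ∀ b : Fin k → M,
      (∀ j, b j ∈ Ms (s i)) → (φ.Realize (Sum.elim (fun j => (a j : M)) b) ↔
        γ ∈ pattern (definedSet φ) D b) := by
    intro i γ
    obtain ⟨a, ha, hab⟩ := (hg (s i) (le_max_left _ _)).1 γ
    exact ⟨fun j => ⟨a j, h.mono (hgε _ (hs i)).le (ha j)⟩, hab⟩
  choose a ha using hav
  have hF : ∀ γ : Iio lam.ord, ∃ z, ∀ i j, e (a i γ j) < z := by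
    intro γ
    have h1 : ∀ i, ∃ z, ∀ j, e (a i γ j) < z := fun i =>
      exists_forall_lt_of_card_lt hreg (fun j => e (a i γ j)) (by
        rw [Cardinal.mk_fin, Cardinal.lift_natCast, Cardinal.lift_uzero]
        exact natCast_lt_aleph0.trans hunc)
    choose z hz using h1
    obtain ⟨y, hy⟩ := exists_forall_lt_of_mk_lt hreg z
      ((mk_Iio_ord kappa).trans_lt (Cardinal.lift_lt.2 hkappa_lt))
    exact ⟨y, fun i j => (hz i j).trans (hy i)⟩
  choose F hF using hF
  refine ⟨_, isClub_setOf_forall_lt hreg hunc F, fun δ hδ => ?_⟩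
  refine ⟨fun i γ => a i (belowIncl δ γ), fun i γ j => (hF _ i j).trans (hδ _ γ.2), fun U => ?_⟩
  constructor
  · rintro ⟨b, rfl⟩
    obtain ⟨b', hb', hpat⟩ := (hg α le_rfl).2 b
    have hgα := hgε α hα
    obtain ⟨i₀, hi₀⟩ := hsge (g α) hgα
    refine ⟨fun j => ⟨b' j, h.mono hgα.le (hb' j)⟩, i₀, fun i hi γ => ?_⟩
    rw [hreal, ha i _ b' fun j => h.mono (hi₀ i hi) (hb' j), hpat]
    rfl
  · rintro ⟨b, i₀, hb⟩
    have hst : ∀ j, ∃ β < ε, (b j : M) ∈ Ms β := by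
      intro j
      have : (b j : M) ∈ ⋃ α, ⋃ (_ : α < ε), (Ms α : Set M) := h.continuous ε hlim ▸ (b j).2
      simpa using this
    choose β hβ hbβ using hst
    obtain ⟨i₁, hi₁⟩ : ∃ i₁, ∀ i, i₁ ≤ i → ∀ j, β j ≤ s i := by
      have hev : ∀ j, ∃ i₁, ∀ i, i₁ ≤ i → β j ≤ s i := fun j => hsge _ (hβ j)
      choose i₁ hi₁ using hev
      obtain ⟨y, hy⟩ := exists_forall_lt_of_card_lt hkappa_reg i₁ (by
        rw [Cardinal.mk_fin, Cardinal.lift_natCast, Cardinal.lift_uzero]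
        exact natCast_lt_aleph0.trans_le hkappa_reg.aleph0_le)
      exact ⟨y, fun i hi j => hi₁ j i ((hy j).le.trans hi)⟩
    refine ⟨fun j => b j, ?_⟩
    ext γ
    rw [← hb (max i₀ i₁) (le_max_left _ _) γ, hreal, ha _ _ _ fun j =>
      h.mono (hi₁ _ (le_max_right _ _) j) (hbβ j)]
    rfl

theorem mk_formula_ip_le (hinf : ℵ₀ ≤ lam) (hcard : L.card ≤ lam) (T : L.Theory) :
    #{p : Σ m k : ℕ, L.Formula (Fin m ⊕ Fin k) // FormulaHasIP T p.2.2} ≤ lam := by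
  have hone : ∀ m k : ℕ, #(L.Formula (Fin m ⊕ Fin k)) ≤ lam := fun m k => by
    have hinj : Function.Injective fun φ : L.Formula (Fin m ⊕ Fin k) =>
        (⟨0, φ⟩ : Σ n, L.BoundedFormula (Fin m ⊕ Fin k) n) := fun φ ψ h => by simpa using h
    refine (Cardinal.mk_le_of_injective hinj).trans (BoundedFormula.card_le.trans ?_)
    refine max_le hinf (Cardinal.add_le_of_le hinf ?_ ?_)
    · exact (Cardinal.lift_lt_aleph0.2 (Cardinal.lt_aleph0_of_finite _)).le.trans hinf
    · simpa using hcard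
  have hsum : ∀ {X : ℕ → Type u}, (∀ n, #(X n) ≤ lam) → #(Σ n, X n) ≤ lam := fun {X} hX => by
    rw [Cardinal.mk_sigma]
    refine (Cardinal.sum_le_sum _ (fun _ => lam) hX).trans ?_
    rw [Cardinal.sum_const, Cardinal.mk_nat, Cardinal.lift_aleph0, Cardinal.lift_uzero]
    exact Cardinal.mul_le_of_le hinf hinf le_rfl
  exact (Cardinal.mk_subtype_le _).trans (hsum fun m => hsum fun k => hone m k)

/-- The invariants of different stages differ on a club of stages. Ultrafilters chosen against
the earlier stage `δ₁` yield families that are not in its local invariants, stationarily often; by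
the closure of `δ₂` their averages and patterns are present before `δ₂`, and almost all of these
families are in the local invariants of the stage `δ₂`. -/
theorem exists_club_forall_clubInv_ne (hreg : lam.IsRegular) (hunc : ℵ₀ < lam)
    (hpow : lam ^< lam = lam) (hcard : L.card < lam) (hkappa_reg : kappa.IsRegular)
    (hkappa_lt : kappa < lam) (h : IsSaturatedChain T lam M Ms) :
    ∃ E : Set (Iio (Order.succ lam).ord), IsClub E ∧
      ∀ δ₁ ∈ E, ∀ δ₂ ∈ E, (δ₂ : Ordinal).cof = kappa → δ₁ < δ₂ →
        ∀ (m k : ℕ) (φ : L.Formula (Fin m ⊕ Fin k)), FormulaHasIP T φ →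
          ∀ (e₁ : Ms δ₁ ≃ Iio lam.ord) (e₂ : Ms δ₂ ≃ Iio lam.ord),
            clubInv φ kappa e₁ ≠ clubInv φ kappa e₂ := by
  have hinf := hunc.le
  have hsreg : (Order.succ lam).IsRegular := isRegular_succ hinf
  let Φ := {p : Σ m k : ℕ, L.Formula (Fin m ⊕ Fin k) // FormulaHasIP T p.2.2}
  have hΦ : lift.{u + 1} #Φ < lift.{u} (lift.{u + 1} (Order.succ lam)) := by
    rw [Cardinal.lift_lift, Cardinal.lift_lt]
    exact Order.lt_succ_of_le (mk_formula_ip_le hinf hcard.le T)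
  have hD : ∀ (α : Iio (Order.succ lam).ord) (p : Φ),
      ∃ D : Iio lam.ord → Ultrafilter (Fin p.1.1 → M),
        #(Set.range (pattern (definedSet p.1.2.2) D)) ≤ lift.{u + 1} lam ∧
        ∀ C : Set (Iio lam.ord), IsClub C → ∃ δ ∈ C,
          (Set.range fun b => belowIncl δ ⁻¹' pattern (definedSet p.1.2.2) D b) ∉
            localInv p.1.2.2 kappa (h.nonempty_equiv α).some δ := by
    intro α p
    refine exists_ultrafilters hreg hunc hpow ?_ _ ⟨kappa.ord, ord_lt_ord.2 hkappa_lt⟩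
      fun δ hδ => mk_localInv_le _ hkappa_reg.aleph0_le _ δ hδ
    exact fun I J hI hJ R => h.saturated.exists_represents h.model hinf
      (h.card_eq ▸ Order.lt_succ lam) p.2 I J hI hJ R
  choose D hDcard hDavoid using hD
  have hstage := fun β α p => exists_stage hinf h _ (D α p) (hDcard α p) β
  choose z hz1 hz2 using hstage
  have hg : ∀ β, ∃ y, ∀ α ≤ β, ∀ p, z β α p < y := by
    intro β
    have h1 : ∀ α, ∃ y, ∀ p, z β α p < y := fun α =>
      exists_forall_lt_of_card_lt hsreg (z β α) (by simpa using hΦ)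
    choose y hy using h1
    obtain ⟨w, hw⟩ := exists_forall_lt_of_mk_lt hsreg
      (fun α : {α // α ≤ β} => y α.1) (mk_subtype_le_lt hsreg.aleph0_le β)
    exact ⟨w, fun α hα p => (hy α p).trans (hw ⟨α, hα⟩)⟩
  choose g hg using hg
  refine ⟨_, isClub_setOf_forall_lt hsreg (hunc.trans (Order.lt_succ lam)) g, ?_⟩
  intro δ₁ _ δ₂ hδ₂ hcof hlt m k φ hφ e₁ e₂ heq
  let p : Φ := ⟨⟨m, k, φ⟩, hφ⟩
  obtain ⟨C₁, hC₁, hin⟩ := exists_club_range_mem_localInv hreg hunc hkappa_reg hkappa_lt h φ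
    (D δ₁ p) δ₁ δ₂ hlt hcof g hδ₂ (fun β hβ => by
      have hle := (hg β δ₁ hβ p).le
      refine ⟨fun γ => ?_, fun b => ?_⟩
      · obtain ⟨a, ha, hab⟩ := hz1 β δ₁ p γ
        exact ⟨a, fun j => h.mono hle (ha j), hab⟩
      · obtain ⟨b', hb', hpat⟩ := hz2 β δ₁ p b
        exact ⟨b', fun j => h.mono hle (hb' j), hpat⟩) e₂
  obtain ⟨C₂, hC₂, heq₂⟩ := exists_club_of_clubInv_eq hreg hunc heq
  obtain ⟨C₃, hC₃, heq₃⟩ := exists_club_localInv_eq (kappa := kappa) hreg hunc φ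
    (h.nonempty_equiv δ₁).some e₁
  have hcof' := cof_Iio_ord_ne_aleph0 hreg hunc
  obtain ⟨δ, ⟨⟨hδ1, hδ2⟩, hδ3⟩, hnot⟩ := hDavoid δ₁ p _ ((hC₁.inter hcof' hC₂).inter hcof' hC₃)
  refine hnot ?_
  have := hin δ hδ1
  rw [← heq₂ δ hδ2, ← heq₃ δ hδ3] at this
  exact this

end Chain

end Invariants

end LimitModel

theorem theorem2p6 {L : FirstOrder.Language.{u, u}} (T : L.Theory) (hT : T.IsComplete)
    (hIP : LimitModel.HasIP T) (lam kappa : Cardinal.{u})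
    (hlam_reg : lam.IsRegular) (hlam_unc : ℵ₀ < lam) (hlam_pow : lam ^< lam = lam)
    (hlam_card : L.card < lam) (hkappa_reg : kappa.IsRegular) (hkappa_lt : kappa < lam)
    (hlam_succ : 2 ^ lam = Order.succ lam) :
    (∀ (M : Type u) [L.Structure M] [Nonempty M]
      (Ms : Iio (Order.succ lam).ord → L.ElementarySubstructure M),
      LimitModel.IsSaturatedChain T lam M Ms →
      ∃ E : Set (Iio (Order.succ lam).ord), IsClub E ∧
        ∀ δ₁ ∈ E, ∀ δ₂ ∈ E, (δ₁ : Ordinal).cof = kappa → (δ₂ : Ordinal).cof = kappa → δ₁ ≠ δ₂ →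
          IsEmpty (Ms δ₁ ≃[L] Ms δ₂) ∧
          ∀ (m k : ℕ) (φ : L.Formula (Fin m ⊕ Fin k)), LimitModel.FormulaHasIP T φ →
            ∀ (e₁ : Ms δ₁ ≃ Iio lam.ord) (e₂ : Ms δ₂ ≃ Iio lam.ord),
              LimitModel.clubInv φ kappa e₁ ≠ LimitModel.clubInv φ kappa e₂) ∧
    ¬ ∃ (Mstar : Type u) (_ : L.Structure Mstar), LimitModel.IsLimitModel T lam kappa Mstar := by
  have part1 : ∀ (M : Type u) [L.Structure M] [Nonempty M]
      (Ms : Iio (Order.succ lam).ord → L.ElementarySubstructure M),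
      LimitModel.IsSaturatedChain T lam M Ms →
      ∃ E : Set (Iio (Order.succ lam).ord), IsClub E ∧
        ∀ δ₁ ∈ E, ∀ δ₂ ∈ E, (δ₁ : Ordinal).cof = kappa → (δ₂ : Ordinal).cof = kappa → δ₁ ≠ δ₂ →
          IsEmpty (Ms δ₁ ≃[L] Ms δ₂) ∧
          ∀ (m k : ℕ) (φ : L.Formula (Fin m ⊕ Fin k)), LimitModel.FormulaHasIP T φ →
            ∀ (e₁ : Ms δ₁ ≃ Iio lam.ord) (e₂ : Ms δ₂ ≃ Iio lam.ord),
              LimitModel.clubInv φ kappa e₁ ≠ LimitModel.clubInv φ kappa e₂ := by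
    intro M _ _ Ms h
    obtain ⟨E, hE, hinv⟩ := LimitModel.exists_club_forall_clubInv_ne hlam_reg hlam_unc hlam_pow
      hlam_card hkappa_reg hkappa_lt h
    have hne : ∀ δ₁ ∈ E, ∀ δ₂ ∈ E, (δ₁ : Ordinal).cof = kappa → (δ₂ : Ordinal).cof = kappa →
        δ₁ ≠ δ₂ → ∀ (m k : ℕ) (φ : L.Formula (Fin m ⊕ Fin k)), LimitModel.FormulaHasIP T φ →
        ∀ (e₁ : Ms δ₁ ≃ Iio lam.ord) (e₂ : Ms δ₂ ≃ Iio lam.ord),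
          LimitModel.clubInv φ kappa e₁ ≠ LimitModel.clubInv φ kappa e₂ := by
      intro δ₁ h₁ δ₂ h₂ hc₁ hc₂ hne m k φ hφ e₁ e₂
      rcases lt_or_gt_of_ne hne with hlt | hlt
      · exact hinv δ₁ h₁ δ₂ h₂ hc₂ hlt m k φ hφ e₁ e₂
      · exact (hinv δ₂ h₂ δ₁ h₁ hc₁ hlt m k φ hφ e₂ e₁).symm
    refine ⟨E, hE, fun δ₁ h₁ δ₂ h₂ hc₁ hc₂ hδ => ⟨⟨fun f => ?_⟩, hne δ₁ h₁ δ₂ h₂ hc₁ hc₂ hδ⟩⟩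
    obtain ⟨m, k, φ, hφ⟩ := hIP
    obtain ⟨e⟩ := h.nonempty_equiv δ₂
    refine hne δ₁ h₁ δ₂ h₂ hc₁ hc₂ hδ m k φ hφ (f.toEquiv.trans e) e ?_
    rw [LimitModel.clubInv, LimitModel.clubInv, LimitModel.localInv_equiv]
  refine ⟨part1, ?_⟩
  rintro ⟨Mstar, _, M, _, _, Ms, h, E', hE', hiso⟩
  obtain ⟨E, hE, hinv⟩ := part1 M Ms h
  have hsreg := isRegular_succ hlam_unc.le
  have hkappa_succ := hkappa_lt.trans (Order.lt_succ lam)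
  have hEE := hE.inter (LimitModel.cof_Iio_ord_ne_aleph0 hsreg
    (hlam_unc.trans (Order.lt_succ lam))) hE'
  -- the points of cofinality `kappa` are stationary, so two of them lie in both clubs
  have hstat : ∀ x : Iio (Order.succ lam).ord, ∃ δ ∈ E ∩ E', x < δ ∧ (δ : Ordinal).cof = kappa := by
    intro x
    obtain ⟨f, hf, hx, δ, hδ, hlub⟩ :=
      LimitModel.exists_mem_isLUB_strictMono hsreg hEE hkappa_reg.ne_zero hkappa_succ x
    exact ⟨δ, hδ, (hx ⟨0, hkappa_reg.ord_pos⟩).trans_le (hlub.1 ⟨_, rfl⟩),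
      LimitModel.cof_eq_of_isLUB_strictMono hkappa_reg hf hlub⟩
  obtain ⟨δ₁, h₁, -, hc₁⟩ := hstat ⟨0, hsreg.ord_pos⟩
  obtain ⟨δ₂, h₂, hlt, hc₂⟩ := hstat δ₁
  obtain ⟨f₁⟩ := hiso δ₁ h₁.2 hc₁
  obtain ⟨f₂⟩ := hiso δ₂ h₂.2 hc₂
  exact (hinv δ₁ h₁.1 δ₂ h₂.1 hc₁ hc₂ hlt.ne).1.false (f₂.symm.comp f₁)
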